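/- Let $n\ge 0$, $N\ge 1$, $B_1,\dots,B_N\in\mathbb R^n$, $b_1,\dots,b_N\in\{1,-1\}$, and let $$f(\tilde y)=f(y,y_0)=\frac1N\sum_{i=1}^N\log\bigl(1+\exp(-b_i(B_i^Ty+y_0))\bigr),\qquad \tilde y=[y;y_0]\in\mathbb R^{n+1},$$ be the logistic loss. Let $\lambda_1\ge 0$ and let $$\varphi(z)=\lambda_1\|z\|_1+\lambda_2\sum_{i=2}^n|z_i-z_{i-1}|\qquad\text{with }\lambda_2=0 .$$ Consider the problem $$\min_{y,y_0,z}\ f(y,y_0)+\varphi(z)\quad\text{s.t.}\quad y-z=0 .\tag{5.5}$$ A point $u=(y,y_0,z,x)\in\mathbb R^n\times\mathbb R\times\mathbb R^n\times\mathbb R^n$ is a KKT point of (5.5) if $\nabla f(y,y_0)+[x;0]=0$, $z=\mathrm{Pr}_\varphi(x+z)$ and $y-z=0$, where $\mathrm{Pr}_\varphi(v)=\arg\min_{w}\{\varphi(w)+\frac12\|w-v\|^2\}$. Let $\overline\Omega$ be the set of KKT points and assume $\overline\Omega\neq\emptyset$. Write $\|v\|_G^2=\langle v,Gv\rangle$ for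 a self-adjoint (possibly indefinite) $G$. Let $\widehat\Sigma_f$ be a symmetric positive semidefinite operator on $\mathbb R^{n+1}$ such that, for all $\tilde y,\tilde y'\in\mathbb R^{n+1}$, $$f(\tilde y)\le\hat f(\tilde y;\tilde y'):=f(\tilde y')+\langle\nabla f(\tilde y'),\tilde y-\tilde y'\rangle+\tfrac12\|\tilde y-\tilde y'\|_{\widehat\Sigma_f}^2$$ (for example $\widehat\Sigma_f=\frac1{4N}\sum_{i=1}^N A_iA_i^T$ with $A_i=[-b_iB_i;-b_i]$). Let $\sigma>0$, $r>0$, $\tau\in(0,(1+\sqrt5)/2)$ and $\mathcal S=-\frac12\widehat\Sigma_f+\mathrm{Diag}(0,\sigma r)$. Starting from an arbitrary $u^0=(y^0,y^0_0,z^0,x^0)$, let $u^k=(y^k,y_0^k,z^k,x^k)$, $\tilde y^k=[y^k;y_0^k]$, be generated for $k=0,1,2,\dots$ by $$\begin{cases}\tilde y^{k+1}=\arg\min_{\tilde y}\ \hat f(\tilde y;\tilde y^k)+\varphi(z^k)+\langle y-z^k,x^k\rangle+\frac\sigma2\|y-z^k\|^2+\frac12\|\tilde y-\tilde y^k\|_{\mathcal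 S}^2,\\ z^{k+1}=\arg\min_z\ \varphi(z)+\frac\sigma2\|z-(y^{k+1}+x^k/\sigma)\|^2,\\ x^{k+1}=x^k+\tau\sigma(y^{k+1}-z^{k+1}).\end{cases}\tag{5.6}$$ Then $\{u^k\}$ converges linearly to a KKT point of (5.5). Precisely, there is $\bar u\in\overline\Omega$ with $u^k\to\bar u$ such that: (i) there is $\mu\in(0,1)$ with $$\mathrm{dist}^2_{\mathcal M}(u^{k+1},\overline\Omega)\le\mu\,\mathrm{dist}^2_{\mathcal M}(u^{k},\overline\Omega)\qquad\text{for all }k\ge1,$$ where $\mathrm{dist}^2_{\mathcal M}(u,\overline\Omega)=\inf_{w\in\overline\Omega}\|u-w\|^2_{\mathcal M}$, $$\|(\tilde y,z,x)\|_{\mathcal M}^2=\|\tilde y\|^2_{\widehat\Sigma_f+\mathcal S}+\sigma\|z\|^2+(\tau\sigma)^{-1}\|x\|^2+s_\tau\sigma\|y-z\|^2,\qquad s_\tau=\tfrac14\bigl(5-\tau-3\min(\tau,\tau^{-1})\bigr);$$ (ii) there are $C>0$ and $q\in(0,1)$ with $\|u^k-\bar u\|\le Cq^k$ for all $k\ge0$.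 -/

import Mathlib

open scoped Gradient InnerProductSpace

noncomputable section

namespace LassoLogistic

/-- `ℝⁿ` with the Euclidean norm. -/
abbrev Vec (n : ℕ) := EuclideanSpace ℝ (Fin n)

/-- `ℝⁿ⁺¹ = ℝⁿ × ℝ` with the Euclidean norm; its points are `ỹ = [y; y₀]`. -/
abbrev Ext (n : ℕ) := WithLp 2 (Vec n × ℝ)

/-- The vector `[y; y₀]`. -/
def ext {n : ℕ} (y : Vec n) (y₀ : ℝ) : Ext n := WithLp.toLp 2 (y, y₀)

/-- The space of primal-dual points `u = (ỹ, z, x)` with the Euclidean norm. -/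
abbrev Pt (n : ℕ) := WithLp 2 (Ext n × WithLp 2 (Vec n × Vec n))

/-- The component `ỹ = [y; y₀]` of `u`. -/
def Pt.yt {n : ℕ} (u : Pt n) : Ext n := u.fst

/-- The component `y` of `u`. -/
def Pt.y {n : ℕ} (u : Pt n) : Vec n := u.fst.fst

/-- The component `z` of `u`. -/
def Pt.z {n : ℕ} (u : Pt n) : Vec n := u.snd.fst

/-- The component `x` of `u` (the multiplier of the constraint `y - z = 0`). -/
def Pt.x {n : ℕ} (u : Pt n) : Vec n := u.snd.snd

/-- The logistic loss `f(y, y₀) = (1/N) ∑ᵢ log (1 + exp (-bᵢ (Bᵢᵀ y + y₀)))`. -/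
def loss {n N : ℕ} (B : Fin N → Vec n) (b : Fin N → ℝ) (v : Ext n) : ℝ :=
  (1 / (N : ℝ)) * ∑ i, Real.log (1 + Real.exp (-(b i) * (⟪B i, v.fst⟫_ℝ + v.snd)))

/-- The fused Lasso regularizer `φ(y) = λ₁ ‖y‖₁ + λ₂ ∑_{i=2}^n |yᵢ - yᵢ₋₁|`. -/
def fusedLasso {n : ℕ} (lam₁ lam₂ : ℝ) (y : Vec n) : ℝ :=
  lam₁ * ∑ i, |y i| +
    lam₂ * ∑ i : Fin n, ∑ j : Fin n, if (i : ℕ) + 1 = (j : ℕ) then |y j - y i| else 0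

/-- `‖v‖²_G = ⟨v, G v⟩` for a (possibly indefinite) linear operator `G`. -/
def normSq {n : ℕ} (G : Ext n →L[ℝ] Ext n) (v : Ext n) : ℝ := ⟪v, G v⟫_ℝ

/-- The quadratic model
`f̂(v; v') = f(v') + ⟨∇f(v'), v - v'⟩ + ½ ‖v - v'‖²_Σ` of `f` at `v'`. -/
def model {n : ℕ} (f : Ext n → ℝ) (Sig : Ext n →L[ℝ] Ext n) (v v' : Ext n) : ℝ :=
  f v' + ⟪∇ f v', v - v'⟫_ℝ + (1 / 2) * normSq Sig (v - v')

/-- `Σ` is self-adjoint positive semidefinite and the quadratic model it defines majorizes `f`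
at every point. -/
def IsMajorizer {n : ℕ} (f : Ext n → ℝ) (Sig : Ext n →L[ℝ] Ext n) : Prop :=
  Sig.IsPositive ∧ ∀ v v' : Ext n, f v ≤ model f Sig v v'

/-- The diagonal operator `Diag(0, c)`, `[y; y₀] ↦ [0; c y₀]`. -/
def diagZero (n : ℕ) (c : ℝ) : Ext n →L[ℝ] Ext n :=
  c • InnerProductSpace.rankOne ℝ (ext (0 : Vec n) 1) (ext (0 : Vec n) 1)

/-- The indefinite proximal term `S = -½ Σ + Diag(0, σ r)`. -/
def proxTerm {n : ℕ} (Sig : Ext n →L[ℝ] Ext n) (sig r : ℝ) : Ext n →L[ℝ] Ext n :=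
  -((1 / 2 : ℝ) • Sig) + diagZero n (sig * r)

/-- The majorized augmented Lagrangian
`f̂(ỹ; ỹ') + φ(z) + ⟨y - z, x⟩ + (σ/2) ‖y - z‖²`. -/
def majAugLag {n : ℕ} (f : Ext n → ℝ) (φ : Vec n → ℝ) (Sig : Ext n →L[ℝ] Ext n) (sig : ℝ)
    (v : Ext n) (z x : Vec n) (v' : Ext n) : ℝ :=
  model f Sig v v' + φ z + ⟪v.fst - z, x⟫_ℝ + sig / 2 * ‖v.fst - z‖ ^ 2

/-- `p = Pr_φ(v)`: `p` minimizes `φ(z) + ½ ‖z - v‖²` over `z ∈ ℝⁿ`. -/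
def IsProx {n : ℕ} (φ : Vec n → ℝ) (v p : Vec n) : Prop :=
  IsMinOn (fun z => φ z + (1 / 2) * ‖z - v‖ ^ 2) Set.univ p

/-- The KKT points of `min f(y, y₀) + φ(z)` subject to `y - z = 0`:
`∇f(y, y₀) + [x; 0] = 0`, `z = Pr_φ(x + z)`, `y - z = 0`. -/
def kktSet {n : ℕ} (f : Ext n → ℝ) (φ : Vec n → ℝ) : Set (Pt n) :=
  {u | ∇ f u.yt + ext u.x 0 = 0 ∧ IsProx φ (u.x + u.z) u.z ∧ u.y - u.z = 0}

/-- `u⁰, u¹, …` is generated by the majorized iPADMM with penalty `σ`, step length `τ`,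
majorizing operator `Σ` and proximal term `S` (on the `ỹ`-block only). -/
def IsIPADMM {n : ℕ} (f : Ext n → ℝ) (φ : Vec n → ℝ) (Sig S : Ext n →L[ℝ] Ext n)
    (sig tau : ℝ) (u : ℕ → Pt n) : Prop :=
  ∀ k : ℕ,
    IsMinOn (fun v : Ext n => majAugLag f φ Sig sig v (u k).z (u k).x (u k).yt
        + (1 / 2) * normSq S (v - (u k).yt)) Set.univ (u (k + 1)).yt ∧
    IsMinOn (fun z : Vec n => φ z + sig / 2 * ‖z - ((u (k + 1)).y + (1 / sig) • (u k).x)‖ ^ 2)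
        Set.univ (u (k + 1)).z ∧
    (u (k + 1)).x = (u k).x + (tau * sig) • ((u (k + 1)).y - (u (k + 1)).z)

/-- `s_τ = (5 - τ - 3 min(τ, τ⁻¹)) / 4`. -/
def sTau (tau : ℝ) : ℝ := (5 - tau - 3 * min tau tau⁻¹) / 4

/-- `‖u‖²_M` for `M = Diag(Σ + S, σ I, (τσ)⁻¹ I) + s_τ σ E E*`, `E*(ỹ, z, x) = y - z`. -/
def normMSq {n : ℕ} (Sig S : Ext n →L[ℝ] Ext n) (sig tau : ℝ) (u : Pt n) : ℝ :=
  normSq (Sig + S) u.yt + sig * ‖u.z‖ ^ 2 + (tau * sig)⁻¹ * ‖u.x‖ ^ 2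
    + sTau tau * sig * ‖u.y - u.z‖ ^ 2

/-- `dist²_M(u, Ω) = inf_{w ∈ Ω} ‖u - w‖²_M`. -/
def distMSq {n : ℕ} (Sig S : Ext n →L[ℝ] Ext n) (sig tau : ℝ) (Om : Set (Pt n)) (u : Pt n) : ℝ :=
  sInf ((fun w => normMSq Sig S sig tau (u - w)) '' Om)

/-- The vector `Aᵢ = [-bᵢ Bᵢ; -bᵢ]`. -/
def dataVec {n N : ℕ} (B : Fin N → Vec n) (b : Fin N → ℝ) (i : Fin N) : Ext n :=
  ext (-(b i) • B i) (-(b i))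

/-- The operator `(1/(4N)) A Aᵀ = (1/(4N)) ∑ᵢ Aᵢ Aᵢᵀ`. -/
def stdSigma {n N : ℕ} (B : Fin N → Vec n) (b : Fin N → ℝ) : Ext n →L[ℝ] Ext n :=
  (1 / (4 * (N : ℝ))) • ∑ i, InnerProductSpace.rankOne ℝ (dataVec B b i) (dataVec B b i)

/-- `log (1 + eˢ) ≤ log (1 + eᵗ) + (eᵗ / (1 + eᵗ)) (s - t) + (s - t)² / 8`. -/
theorem log_one_add_exp_le (s t : ℝ) :
    Real.log (1 + Real.exp s) ≤ Real.log (1 + Real.exp t)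
      + Real.exp t / (1 + Real.exp t) * (s - t) + (1 / 8) * (s - t) ^ 2 := by
  have hpos : ∀ x : ℝ, 0 < 1 + Real.exp x := fun x => by positivity
  have hg : ∀ x : ℝ, HasDerivAt (fun x => Real.log (1 + Real.exp x))
      (Real.exp x / (1 + Real.exp x)) x := fun x =>
    ((Real.hasDerivAt_exp x).const_add 1).log (hpos x).ne'
  have hp : ∀ x : ℝ, HasDerivAt (fun x => x / 4 - Real.exp x / (1 + Real.exp x))
      (1 / 4 - (Real.exp x * (1 + Real.exp x) - Real.exp x * Real.exp x)
        / (1 + Real.exp x) ^ 2) x := fun x =>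
    ((hasDerivAt_id x).div_const 4).sub
      ((Real.hasDerivAt_exp x).div ((Real.hasDerivAt_exp x).const_add 1) (hpos x).ne')
  have hmono : Monotone (fun x : ℝ => x / 4 - Real.exp x / (1 + Real.exp x)) := by
    apply monotone_of_deriv_nonneg (fun x => (hp x).differentiableAt)
    intro x
    rw [(hp x).deriv, sub_nonneg, div_le_div_iff₀ (by have := hpos x; positivity) (by norm_num)]
    nlinarith [sq_nonneg (1 - Real.exp x)]
  have hh : ∀ x : ℝ, HasDerivAt (fun x => Real.exp t / (1 + Real.exp t) * (x - t)
      + (1 / 8) * (x - t) ^ 2 - Real.log (1 + Real.exp x))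
      ((x / 4 - Real.exp x / (1 + Real.exp x)) - (t / 4 - Real.exp t / (1 + Real.exp t))) x := by
    intro x
    have h1 := ((((hasDerivAt_id x).sub_const t).const_mul
      (Real.exp t / (1 + Real.exp t))).add
      ((((hasDerivAt_id x).sub_const t).pow 2).const_mul (1 / 8 : ℝ))).sub (hg x)
    refine h1.congr_deriv ?_
    simp
    ring
  rcases le_total t s with hts | hst
  · have := monotoneOn_of_deriv_nonneg (convex_Ici t)
      (fun x _ => (hh x).continuousAt.continuousWithinAt)
      (fun x _ => (hh x).differentiableAt.differentiableWithinAt)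
      (fun x hx => by
        rw [interior_Ici] at hx
        rw [(hh x).deriv]
        exact sub_nonneg.2 (hmono (le_of_lt hx))) (Set.self_mem_Ici) (Set.mem_Ici.2 hts) hts
    simp only [sub_self] at this
    nlinarith
  · have := antitoneOn_of_deriv_nonpos (convex_Iic t)
      (fun x _ => (hh x).continuousAt.continuousWithinAt)
      (fun x _ => (hh x).differentiableAt.differentiableWithinAt)
      (fun x hx => by
        rw [interior_Iic] at hx
        rw [(hh x).deriv]
        exact sub_nonpos.2 (hmono (le_of_lt hx))) (Set.mem_Iic.2 hst) (Set.self_mem_Iic) hst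
    simp only [sub_self] at this
    nlinarith

/-- `(1/(4N)) A Aᵀ` is positive semidefinite and majorizes the logistic loss. -/
theorem stdSigma_isMajorizer {n N : ℕ} (B : Fin N → Vec n) (b : Fin N → ℝ) :
    IsMajorizer (loss B b) (stdSigma B b) := by
  have harg : ∀ i (v : Ext n), -(b i) * (⟪B i, v.fst⟫_ℝ + v.snd) = ⟪dataVec B b i, v⟫_ℝ := by
    intro i v
    simp [dataVec, ext, WithLp.prod_inner_apply, inner_smul_left]
    ring
  have hloss : loss B b = fun v => (1 / (N : ℝ)) *
      ∑ i, Real.log (1 + Real.exp ⟪dataVec B b i, v⟫_ℝ) := by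
    funext v
    simp only [loss, harg]
  refine ⟨?_, fun v v' => ?_⟩
  · exact (ContinuousLinearMap.isPositive_sum _ fun i _ =>
      InnerProductSpace.isPositive_rankOne_self _).smul_of_nonneg (by positivity)
  · have hgrad : HasGradientAt (loss B b) ((1 / (N : ℝ)) • ∑ i,
        (Real.exp ⟪dataVec B b i, v'⟫_ℝ / (1 + Real.exp ⟪dataVec B b i, v'⟫_ℝ))
          • dataVec B b i) v' := by
      rw [hasGradientAt_iff_hasFDerivAt, hloss]
      have h : ∀ i ∈ (Finset.univ : Finset (Fin N)), HasFDerivAt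
          (fun v : Ext n => Real.log (1 + Real.exp ⟪dataVec B b i, v⟫_ℝ)) _ v' := fun i _ =>
        (((((innerSL ℝ (dataVec B b i)).hasFDerivAt (x := v')).exp).const_add 1).log
          (by positivity))
      refine ((HasFDerivAt.fun_sum h).const_mul (1 / (N : ℝ))).congr_fderiv ?_
      ext w <;> simp [div_eq_inv_mul, mul_assoc]
    rw [model, hgrad.gradient, hloss, normSq]
    simp only [stdSigma, smul_apply, sum_apply,
      InnerProductSpace.rankOne_apply, real_inner_smul_left, real_inner_smul_right, sum_inner,
      inner_sum]
    have key : ∑ i, Real.log (1 + Real.exp ⟪dataVec B b i, v⟫_ℝ) ≤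
        ∑ i, (Real.log (1 + Real.exp ⟪dataVec B b i, v'⟫_ℝ)
          + Real.exp ⟪dataVec B b i, v'⟫_ℝ / (1 + Real.exp ⟪dataVec B b i, v'⟫_ℝ)
            * ⟪dataVec B b i, v - v'⟫_ℝ
          + (1 / 8) * (⟪dataVec B b i, v - v'⟫_ℝ * ⟪v - v', dataVec B b i⟫_ℝ)) := by
      refine Finset.sum_le_sum fun i _ => ?_
      have := log_one_add_exp_le ⟪dataVec B b i, v⟫_ℝ ⟪dataVec B b i, v'⟫_ℝ
      rw [← inner_sub_right] at this
      rw [real_inner_comm (dataVec B b i) (v - v'), ← sq]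
      exact this
    have h2 := mul_le_mul_of_nonneg_left key (by positivity : (0 : ℝ) ≤ 1 / (N : ℝ))
    rw [Finset.sum_add_distrib, Finset.sum_add_distrib, ← Finset.mul_sum] at h2
    refine h2.trans (le_of_eq ?_)
    rw [one_div_mul_eq_div, one_div (4 * (N : ℝ)), mul_inv]
    ring

end LassoLogistic

end

/-!
The iterates converge linearly because two estimates meet in the single quantity `stepSq`, the
squared size of the changes of `y₀`, `z` and of the constraint residuals in one step.

*Descent* (`IsIPADMM.exists_descent`). Adding the optimality conditions of the two subproblems,
paired with the error relative to a KKT point `w`, telescopes to `‖uᵏ - w‖²_M`. The gradient at the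
old point is paired with the error at the new one. Cocoercivity of `∇f` with respect to the
majorizing operator bounds this from below by `-¼ ‖ỹᵏ⁺¹ - ỹᵏ‖²_Σ`
(`neg_quarter_normSq_le_inner_gradient`), which is exactly what `Σ + S = ½ Σ + Diag(0, σ r)` pays
for. The remaining cross term is handled by monotonicity of `∂φ` at consecutive `z`-steps and
Young's inequality; `s_τ` is the weight for which this telescopes with a positive remainder
whenever `1 + τ - τ² > 0` (`exists_le_sTau_combination`). Two consecutive steps are involved, so
the estimate starts at `k = 1`.

*Error bound* (`exists_error_bound`). On the KKT set both the multiplier `x` and the values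
`⟪Aᵢ, ỹ⟫` are constant, since the loss is strictly convex in these values. As the inverse of the
subdifferential of `λ₁ ‖·‖₁` at a point is a polyhedral cone, the KKT set is a polyhedron, and
Hoffman's bound (`hoffman`) applies to it. Let `R` be the residual of the optimality conditions at a
point of a bounded set and `d` its distance to the KKT set. Strong monotonicity of the loss on
bounded sets bounds the squared violation of the equalities `⟪Aᵢ, ỹ⟫ = const` by a multiple of
`R d`; the multiplier and, through it, the sign conditions on `z` are violated by no more than a
multiple of `R + √(R d)`. Hence `d ≤ c₁ R + c₂ √(R d)`, which gives `d ≤ c R`.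

The residual at `uᵏ⁺¹` and the step `uᵏ⁺¹ - uᵏ` are at most a multiple of the square root of
`stepSq` (`IsIPADMM.exists_residual_le`), so that a fixed fraction of the squared distance to the
KKT set is lost in each step (`linear_convergence`). Both the contraction and the geometric
convergence of the iterates follow.
-/

noncomputable section

namespace LassoLogistic

/-! ### Hoffman's error bound for polyhedra -/

section Hoffman

variable {V ι : Type*} [NormedAddCommGroup V] [InnerProductSpace ℝ V] [FiniteDimensional ℝ V]

/-- On the polar of the cone `{t | ∀ j ∈ J, ⟪a j, t⟫ ≤ 0}` the norm is controlled by the largest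
of the numbers `⟪a j, d⟫`, `j ∈ J`: a unit vector of the polar cannot lie in the cone itself, and
the unit vectors of the polar form a compact set. -/
theorem norm_le_of_mem_polar (a : ι → V) (J : Finset ι) :
    ∃ κ : ℝ, 0 ≤ κ ∧ ∀ d : V, (∀ t : V, (∀ j ∈ J, ⟪a j, t⟫_ℝ ≤ 0) → ⟪d, t⟫_ℝ ≤ 0) →
      ∀ ε : ℝ, 0 ≤ ε → (∀ j ∈ J, ⟪a j, d⟫_ℝ ≤ ε) → ‖d‖ ≤ κ * ε := by
  set K : Set V := Metric.sphere (0 : V) 1 ∩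
    {d | ∀ t : V, (∀ j ∈ J, ⟪a j, t⟫_ℝ ≤ 0) → ⟪d, t⟫_ℝ ≤ 0} with hK
  have hcl : IsClosed {d : V | ∀ t : V, (∀ j ∈ J, ⟪a j, t⟫_ℝ ≤ 0) → ⟪d, t⟫_ℝ ≤ 0} := by
    simp only [Set.ofPred_forall]
    exact isClosed_iInter fun t => isClosed_iInter fun _ =>
      isClosed_le (by fun_prop) continuous_const
  have hKc : IsCompact K := (isCompact_sphere _ _).inter_right hcl
  set g : V → ℝ := fun d => ∑ j ∈ J, max 0 ⟪a j, d⟫_ℝ with hg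
  have hgc : Continuous g := by fun_prop
  have hpos : ∀ d ∈ K, 0 < g d := by
    rintro d ⟨hd1, hd2⟩
    by_contra hcon
    have h0 : g d = 0 :=
      le_antisymm (not_lt.1 hcon) (Finset.sum_nonneg fun _ _ => le_max_left _ _)
    have h1 := (Finset.sum_eq_zero_iff_of_nonneg (fun _ _ => le_max_left _ _)).1 h0
    have h2 := hd2 d fun j hj => by simpa using h1 j hj
    have h3 : ‖d‖ = 1 := by simpa using hd1
    rw [real_inner_self_eq_norm_sq, h3] at h2
    norm_num at h2
  obtain ⟨m, hm, hmle⟩ : ∃ m : ℝ, 0 < m ∧ ∀ d ∈ K, m ≤ g d := by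
    rcases K.eq_empty_or_nonempty with h | h
    · exact ⟨1, one_pos, by simp [h]⟩
    · obtain ⟨d, hd, hmin⟩ := hKc.exists_isMinOn h hgc.continuousOn
      exact ⟨g d, hpos d hd, fun e he => hmin he⟩
  refine ⟨m⁻¹ * J.card, by positivity, fun d hd ε hε hle => ?_⟩
  rcases eq_or_ne d 0 with rfl | hd0
  · simp only [norm_zero]; positivity
  have hn : 0 < ‖d‖ := norm_pos_iff.2 hd0
  have hmem : ‖d‖⁻¹ • d ∈ K := by
    refine ⟨by simp [norm_smul, hn.ne'], fun t ht => ?_⟩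
    rw [real_inner_smul_left]
    exact mul_nonpos_of_nonneg_of_nonpos (by positivity) (hd t ht)
  have h1 : m ≤ ‖d‖⁻¹ * (J.card * ε) := by
    refine (hmle _ hmem).trans ?_
    rw [← nsmul_eq_mul, ← Finset.sum_const, Finset.mul_sum]
    refine Finset.sum_le_sum fun j hj => ?_
    rw [real_inner_smul_right]
    exact max_le (by positivity) (mul_le_mul_of_nonneg_left (hle j hj) (by positivity))
  rw [mul_assoc, le_inv_mul_iff₀ hm]
  rwa [le_inv_mul_iff₀ hn, mul_comm] at h1

/-- **Hoffman's error bound**: the distance to a nonempty polyhedron is at most a constant times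
the largest violation of the inequalities defining it. The constant does not depend on the
right-hand sides `c`. -/
theorem hoffman [Fintype ι] (a : ι → V) : ∃ κ : ℝ, 0 ≤ κ ∧ ∀ c : ι → ℝ,
    (∃ v : V, ∀ j, ⟪a j, v⟫_ℝ ≤ c j) → ∀ (v : V) (ε : ℝ), 0 ≤ ε → (∀ j, ⟪a j, v⟫_ℝ ≤ c j + ε) →
      ∃ p : V, (∀ j, ⟪a j, p⟫_ℝ ≤ c j) ∧ ‖v - p‖ ≤ κ * ε := by
  classical
  choose κ hκ0 hκ using norm_le_of_mem_polar a
  refine ⟨∑ J, κ J, Finset.sum_nonneg fun J _ => hκ0 J, fun c hne v ε hε hv => ?_⟩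
  set P : Set V := {p | ∀ j, ⟪a j, p⟫_ℝ ≤ c j} with hP
  have hPcl : IsClosed P := by
    simp only [hP, Set.ofPred_forall]
    exact isClosed_iInter fun j => isClosed_le (by fun_prop) continuous_const
  have hPconv : Convex ℝ P := by
    intro x hx y hy s t hs ht hst j
    rw [inner_add_right, real_inner_smul_right, real_inner_smul_right]
    have := mul_le_mul_of_nonneg_left (hx j) hs
    have := mul_le_mul_of_nonneg_left (hy j) ht
    have : c j = s * c j + t * c j := by rw [← add_mul, hst, one_mul]
    linarith
  obtain ⟨p, hp, hpmin⟩ := exists_norm_eq_iInf_of_complete_convex hne hPcl.isComplete hPconv v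
  have hnormal := (norm_eq_iInf_iff_real_inner_le_zero hPconv hp).1 hpmin
  refine ⟨p, hp, ?_⟩
  -- the constraints active at the projection `p`
  set J : Finset ι := Finset.univ.filter fun j => ⟪a j, p⟫_ℝ = c j with hJ
  have hact : ∀ j ∈ J, ⟪a j, p⟫_ℝ = c j := fun j hj => (Finset.mem_filter.1 hj).2
  have hle : ‖v - p‖ ≤ κ J * ε := by
    refine hκ J _ (fun t ht => ?_) ε hε fun j hj => ?_
    · -- a short step from `p` along `t` violates no constraint
      have hev : ∀ᶠ s : ℝ in nhdsWithin 0 (Set.Ioi 0), p + s • t ∈ P := by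
        simp only [hP, Set.mem_ofPred_eq]
        rw [Filter.eventually_all]
        intro j
        by_cases hj : j ∈ J
        · filter_upwards [self_mem_nhdsWithin] with s hs
          rw [inner_add_right, real_inner_smul_right, hact j hj]
          have := mul_nonpos_of_nonneg_of_nonpos (le_of_lt (Set.mem_Ioi.1 hs)) (ht j hj)
          linarith
        · have hlt : ⟪a j, p⟫_ℝ < c j :=
            lt_of_le_of_ne (hp j) fun h => hj (Finset.mem_filter.2 ⟨Finset.mem_univ _, h⟩)
          have hcont : ContinuousAt (fun s : ℝ => ⟪a j, p + s • t⟫_ℝ) 0 := by fun_prop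
          have := hcont.eventually_lt_const (by simpa using hlt)
          exact (this.filter_mono nhdsWithin_le_nhds).mono fun s hs => hs.le
      obtain ⟨s, hs, hs0⟩ := (hev.and self_mem_nhdsWithin).exists
      have := hnormal _ hs
      rw [add_sub_cancel_left, real_inner_smul_right] at this
      exact nonpos_of_mul_nonpos_right this hs0
    · rw [inner_sub_right, hact j hj]
      linarith [hv j]
  exact hle.trans (mul_le_mul_of_nonneg_right
    (Finset.single_le_sum (fun J _ => hκ0 J) (Finset.mem_univ J)) hε)

end Hoffman

/-! ### The logistic loss -/

theorem exp_div_one_add_exp (t : ℝ) : Real.exp t / (1 + Real.exp t) = Real.sigmoid t := by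
  have := Real.exp_pos t
  rw [Real.sigmoid_def, Real.exp_neg]
  field_simp
  ring

/-- The tangent line inequality for the convex function `s ↦ log (1 + eˢ)`. -/
theorem le_log_one_add_exp (s t : ℝ) :
    Real.log (1 + Real.exp t) + Real.sigmoid t * (s - t) ≤ Real.log (1 + Real.exp s) := by
  have hs : 0 < 1 + Real.exp s := by positivity
  have ht : 0 < 1 + Real.exp t := by positivity
  have hc := convexOn_exp.2 (Set.mem_univ 0) (Set.mem_univ (s - t))
    (sub_nonneg.2 (Real.sigmoid_le_one t)) (Real.sigmoid_nonneg t) (by ring)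
  simp only [smul_eq_mul, mul_zero, zero_add, Real.exp_zero, mul_one] at hc
  have h2 : 1 - Real.sigmoid t + Real.sigmoid t * Real.exp (s - t)
      = (1 + Real.exp s) / (1 + Real.exp t) := by
    rw [← exp_div_one_add_exp, Real.exp_sub]
    field_simp
    ring
  rw [h2] at hc
  have := Real.log_le_log (Real.exp_pos _) hc
  rw [Real.log_exp, Real.log_div hs.ne' ht.ne'] at this
  linarith

theorem abs_sigmoid_sub_le (s t : ℝ) : |Real.sigmoid s - Real.sigmoid t| ≤ |s - t| := by
  have := Convex.norm_image_sub_le_of_norm_deriv_le (𝕜 := ℝ) (f := Real.sigmoid) (C := 1)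
    (s := Set.univ) (x := t) (y := s) (fun x _ => differentiable_sigmoid x)
    (fun x _ => by
      rw [Real.deriv_sigmoid, Real.norm_eq_abs, abs_le]
      have := Real.sigmoid_nonneg x
      have := Real.sigmoid_le_one x
      constructor <;> nlinarith) convex_univ (Set.mem_univ _) (Set.mem_univ _)
  simpa using this

theorem exists_mul_sq_le_sigmoid (ρ : ℝ) : ∃ m : ℝ, 0 < m ∧ ∀ s t : ℝ, |s| ≤ ρ → |t| ≤ ρ →
    m * (s - t) ^ 2 ≤ (Real.sigmoid s - Real.sigmoid t) * (s - t) := by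
  have hp : ∀ x, 0 < Real.sigmoid x * (1 - Real.sigmoid x) := fun x =>
    mul_pos (Real.sigmoid_pos x) (sub_pos.2 (Real.sigmoid_lt_one x))
  have hc : Continuous fun x => Real.sigmoid x * (1 - Real.sigmoid x) :=
    continuous_sigmoid.mul (continuous_const.sub continuous_sigmoid)
  obtain ⟨m, hm, hmle⟩ : ∃ m : ℝ, 0 < m ∧ ∀ x ∈ Set.Icc (-ρ) ρ,
      m ≤ Real.sigmoid x * (1 - Real.sigmoid x) := by
    rcases (Set.Icc (-ρ) ρ).eq_empty_or_nonempty with h | h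
    · exact ⟨1, one_pos, by simp [h]⟩
    · obtain ⟨d, hd, hmin⟩ := isCompact_Icc.exists_isMinOn h hc.continuousOn
      exact ⟨_, hp d, fun e he => hmin he⟩
  have key : ∀ s ∈ Set.Icc (-ρ) ρ, ∀ t ∈ Set.Icc (-ρ) ρ, s ≤ t →
      m * (t - s) ≤ Real.sigmoid t - Real.sigmoid s :=
    (convex_Icc (-ρ) ρ).mul_sub_le_image_sub_of_le_deriv continuous_sigmoid.continuousOn
      differentiable_sigmoid.differentiableOn fun x hx => by
        rw [Real.deriv_sigmoid]
        exact hmle x (interior_subset hx)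
  refine ⟨m, hm, fun s t hs ht => ?_⟩
  rcases le_total s t with h | h
  · nlinarith [key s (abs_le.1 hs) t (abs_le.1 ht) h, sub_nonneg.2 h]
  · nlinarith [key t (abs_le.1 ht) s (abs_le.1 hs) h, sub_nonneg.2 h]

section Loss

variable {n N : ℕ} (B : Fin N → Vec n) (b : Fin N → ℝ)

theorem loss_eq (v : Ext n) :
    loss B b v = (1 / (N : ℝ)) * ∑ i, Real.log (1 + Real.exp ⟪dataVec B b i, v⟫_ℝ) := by
  have harg : ∀ i, -(b i) * (⟪B i, v.fst⟫_ℝ + v.snd) = ⟪dataVec B b i, v⟫_ℝ := by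
    intro i
    simp [dataVec, ext, WithLp.prod_inner_apply, inner_smul_left]
    ring
  simp only [loss, harg]

theorem gradient_loss (v : Ext n) : ∇ (loss B b) v =
    (1 / (N : ℝ)) • ∑ i, Real.sigmoid ⟪dataVec B b i, v⟫_ℝ • dataVec B b i := by
  refine HasGradientAt.gradient ?_
  rw [hasGradientAt_iff_hasFDerivAt, funext (loss_eq B b)]
  have h : ∀ i ∈ (Finset.univ : Finset (Fin N)), HasFDerivAt
      (fun v : Ext n => Real.log (1 + Real.exp ⟪dataVec B b i, v⟫_ℝ)) _ v := fun i _ =>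
    (((((innerSL ℝ (dataVec B b i)).hasFDerivAt (x := v)).exp).const_add 1).log
      (by positivity))
  refine ((HasFDerivAt.fun_sum h).const_mul (1 / (N : ℝ))).congr_fderiv ?_
  refine ContinuousLinearMap.ext fun w => ?_
  simp [← exp_div_one_add_exp, div_eq_inv_mul, mul_assoc]

theorem inner_gradient_loss (v d : Ext n) : ⟪∇ (loss B b) v, d⟫_ℝ =
    (1 / (N : ℝ)) * ∑ i, Real.sigmoid ⟪dataVec B b i, v⟫_ℝ * ⟪dataVec B b i, d⟫_ℝ := by
  rw [gradient_loss, real_inner_smul_left, sum_inner]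
  simp only [real_inner_smul_left]

theorem continuous_gradient_loss : Continuous fun v : Ext n => ∇ (loss B b) v := by
  simp only [gradient_loss]
  have h : ∀ i, Continuous fun v : Ext n => Real.sigmoid ⟪dataVec B b i, v⟫_ℝ := fun i =>
    continuous_sigmoid.comp (by fun_prop)
  fun_prop

theorem loss_add_inner_le (v v' : Ext n) :
    loss B b v' + ⟪∇ (loss B b) v', v - v'⟫_ℝ ≤ loss B b v := by
  rw [loss_eq, loss_eq, inner_gradient_loss, ← mul_add, ← Finset.sum_add_distrib]
  refine mul_le_mul_of_nonneg_left (Finset.sum_le_sum fun i _ => ?_) (by positivity)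
  rw [inner_sub_right]
  exact le_log_one_add_exp _ _

theorem exists_norm_gradient_loss_sub_le : ∃ L : ℝ, 0 ≤ L ∧ ∀ (v w : Ext n) (ε : ℝ),
    (∀ i, |⟪dataVec B b i, v - w⟫_ℝ| ≤ ε) →
      ‖∇ (loss B b) v - ∇ (loss B b) w‖ ≤ L * ε := by
  refine ⟨(1 / (N : ℝ)) * ∑ i, ‖dataVec B b i‖, by positivity, fun v w ε h => ?_⟩
  rw [gradient_loss, gradient_loss, ← smul_sub, ← Finset.sum_sub_distrib, norm_smul,
    Real.norm_of_nonneg (by positivity), mul_assoc, Finset.sum_mul]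
  refine mul_le_mul_of_nonneg_left ((norm_sum_le _ _).trans
    (Finset.sum_le_sum fun i _ => ?_)) (by positivity)
  rw [← sub_smul, norm_smul, mul_comm]
  refine mul_le_mul_of_nonneg_left ?_ (norm_nonneg _)
  refine (abs_sigmoid_sub_le _ _).trans ?_
  rw [← inner_sub_right]
  exact h i

/-- The gradient of the logistic loss is Lipschitz continuous. -/
theorem exists_lipschitz_gradient_loss : ∃ L : ℝ, 0 ≤ L ∧ ∀ v w : Ext n,
    ‖∇ (loss B b) v - ∇ (loss B b) w‖ ≤ L * ‖v - w‖ := by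
  obtain ⟨L, hL, h⟩ := exists_norm_gradient_loss_sub_le B b
  refine ⟨L * ∑ i, ‖dataVec B b i‖, by positivity, fun v w => ?_⟩
  rw [mul_assoc]
  refine h v w _ fun i => (abs_real_inner_le_norm _ _).trans ?_
  exact mul_le_mul_of_nonneg_right (Finset.single_le_sum (f := fun i => ‖dataVec B b i‖)
    (fun _ _ => norm_nonneg _) (Finset.mem_univ i)) (norm_nonneg _)

/-- On bounded sets, the gradient of the logistic loss is strongly monotone in the directions
that the data vectors see. -/
theorem exists_mul_sq_le_inner_gradient_loss (hN : 0 < N) (ρ : ℝ) :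
    ∃ m : ℝ, 0 < m ∧ ∀ v w : Ext n, ‖v‖ ≤ ρ → ‖w‖ ≤ ρ → ∀ i,
      m * ⟪dataVec B b i, v - w⟫_ℝ ^ 2 ≤
        ⟪∇ (loss B b) v - ∇ (loss B b) w, v - w⟫_ℝ := by
  obtain ⟨m, hm, hmle⟩ := exists_mul_sq_le_sigmoid ((∑ i, ‖dataVec B b i‖) * ρ)
  refine ⟨1 / (N : ℝ) * m, by positivity, fun v w hv hw i => ?_⟩
  have hbd : ∀ (x : Ext n), ‖x‖ ≤ ρ → ∀ i,
      |⟪dataVec B b i, x⟫_ℝ| ≤ (∑ i, ‖dataVec B b i‖) * ρ := fun x hx i =>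
    (abs_real_inner_le_norm _ _).trans (mul_le_mul (Finset.single_le_sum
      (f := fun i => ‖dataVec B b i‖) (fun _ _ => norm_nonneg _) (Finset.mem_univ i)) hx
      (norm_nonneg _) (by positivity))
  rw [inner_sub_left, inner_gradient_loss, inner_gradient_loss, ← mul_sub,
    ← Finset.sum_sub_distrib, mul_assoc]
  refine mul_le_mul_of_nonneg_left ?_ (by positivity)
  have hterm : ∀ j, m * ⟪dataVec B b j, v - w⟫_ℝ ^ 2 ≤
      Real.sigmoid ⟪dataVec B b j, v⟫_ℝ * ⟪dataVec B b j, v - w⟫_ℝ -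
        Real.sigmoid ⟪dataVec B b j, w⟫_ℝ * ⟪dataVec B b j, v - w⟫_ℝ := fun j => by
    rw [inner_sub_right, ← sub_mul]
    exact hmle _ _ (hbd v hv j) (hbd w hw j)
  exact (hterm i).trans (Finset.single_le_sum (f := fun j =>
      Real.sigmoid ⟪dataVec B b j, v⟫_ℝ * ⟪dataVec B b j, v - w⟫_ℝ -
        Real.sigmoid ⟪dataVec B b j, w⟫_ℝ * ⟪dataVec B b j, v - w⟫_ℝ)
    (fun j _ => (by positivity : (0 : ℝ) ≤ m * ⟪dataVec B b j, v - w⟫_ℝ ^ 2).trans (hterm j))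
    (Finset.mem_univ i))

end Loss

/-- If `f` satisfies the gradient inequality and is majorized by its quadratic models with
operator `Σ`, then its gradient is cocoercive with respect to `Σ`. The statement pairs the
gradients at `v, w` with a third point `v'`, at the price of `¼ ‖v' - v‖²_Σ`: this constant is
what permits the proximal term `-½ Σ`. -/
theorem neg_quarter_normSq_le_inner_gradient {n : ℕ} {f : Ext n → ℝ} {Sig : Ext n →L[ℝ] Ext n}
    (hf : ∀ v v', f v' + ⟪∇ f v', v - v'⟫_ℝ ≤ f v) (hSig : IsMajorizer f Sig)
    (v v' w : Ext n) :
    -(1 / 4) * normSq Sig (v' - v) ≤ ⟪∇ f v - ∇ f w, v' - w⟫_ℝ := by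
  -- convexity and majorization are compared at `v + d` and at `w - d`
  set d : Ext n := (1 / 2 : ℝ) • (v' - v) with hd
  have h1 := hf (v + d) w
  have h2 := hSig.2 (v + d) v
  have h3 := hf (w - d) v
  have h4 := hSig.2 (w - d) w
  have hv' : v' = v + (2 : ℝ) • d := by rw [hd, smul_smul]; norm_num
  have e1 : v + d - v = d := by abel
  have e2 : w - d - w = -d := by abel
  have e3 : v' - v = (2 : ℝ) • d := by rw [hv']; abel
  rw [model, e1] at h2
  rw [model, e2] at h4
  rw [e3, hv']
  simp only [normSq, map_smul, map_neg, inner_neg_left, inner_neg_right, inner_sub_left,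
    inner_sub_right, inner_add_right, real_inner_smul_left, real_inner_smul_right] at *
  linarith

/-! ### Subgradients of the `ℓ¹` norm -/

section L1

variable {n : ℕ} {lam : ℝ}

/-- `x` is a subgradient of `λ ‖·‖₁` at `z`, in coordinates: `|xᵢ| ≤ λ`, with `xᵢ = λ sign zᵢ`
wherever `zᵢ ≠ 0`. -/
def IsL1Subgradient (lam : ℝ) (x z : Vec n) : Prop :=
  ∀ i, |x i| ≤ lam ∧ x i * z i = lam * |z i|

theorem fusedLasso_zero (z : Vec n) : fusedLasso lam 0 z = lam * ∑ i, |z i| := by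
  simp [fusedLasso]

/-- The sign description of the inverse of the subdifferential: for fixed `x` it cuts out a
polyhedral cone of points `z`. -/
theorem isL1Subgradient_iff {x z : Vec n} : IsL1Subgradient lam x z ↔
    ∀ i, |x i| ≤ lam ∧ (x i < lam → z i ≤ 0) ∧ (-lam < x i → 0 ≤ z i) := by
  refine forall_congr' fun i => and_congr_right fun h => ?_
  obtain ⟨h1, h2⟩ := abs_le.1 h
  constructor
  · intro heq
    refine ⟨fun hlt => ?_, fun hlt => ?_⟩
    · by_contra! hz
      rw [abs_of_pos hz] at heq
      exact hlt.ne (mul_right_cancel₀ hz.ne' heq)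
    · by_contra! hz
      rw [abs_of_neg hz] at heq
      have : x i * z i = -lam * z i := by rw [heq]; ring
      exact hlt.ne' (mul_right_cancel₀ hz.ne this)
  · rintro ⟨ha, hb⟩
    rcases lt_trichotomy (z i) 0 with hz | hz | hz
    · rw [abs_of_neg hz, le_antisymm (not_lt.1 fun h => hz.not_ge (hb h)) h1]
      ring
    · simp [hz]
    · rw [abs_of_pos hz, le_antisymm h2 (not_lt.1 fun h => hz.not_ge (ha h))]

theorem IsL1Subgradient.inner_sub_nonneg {x z x' z' : Vec n} (h : IsL1Subgradient lam x z)
    (h' : IsL1Subgradient lam x' z') : 0 ≤ ⟪x - x', z - z'⟫_ℝ := by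
  rw [PiLp.inner_apply]
  refine Finset.sum_nonneg fun i _ => ?_
  obtain ⟨h1, h2⟩ := h i
  obtain ⟨h3, h4⟩ := h' i
  have h5 : x i * z' i ≤ lam * |z' i| := (le_abs_self _).trans (by rw [abs_mul]; gcongr)
  have h6 : x' i * z i ≤ lam * |z i| := (le_abs_self _).trans (by rw [abs_mul]; gcongr)
  simp only [PiLp.sub_apply, RCLike.inner_apply, conj_trivial]
  nlinarith

theorem IsL1Subgradient.add_inner_le {x z : Vec n} (h : IsL1Subgradient lam x z) (w : Vec n) :
    fusedLasso lam 0 z + ⟪x, w - z⟫_ℝ ≤ fusedLasso lam 0 w := by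
  rw [fusedLasso_zero, fusedLasso_zero, PiLp.inner_apply, Finset.mul_sum, Finset.mul_sum,
    ← Finset.sum_add_distrib]
  refine Finset.sum_le_sum fun i _ => ?_
  obtain ⟨h1, h2⟩ := h i
  have h5 : x i * w i ≤ lam * |w i| := (le_abs_self _).trans (by rw [abs_mul]; gcongr)
  simp only [PiLp.sub_apply, RCLike.inner_apply, conj_trivial]
  nlinarith

/-- The optimality condition of a proximal step for `λ ‖·‖₁`. -/
theorem isL1Subgradient_of_isMinOn (hl : 0 ≤ lam) {c : ℝ} {a p : Vec n}
    (h : IsMinOn (fun z => fusedLasso lam 0 z + c / 2 * ‖z - a‖ ^ 2) Set.univ p) :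
    IsL1Subgradient lam (c • (a - p)) p := by
  intro i
  set x : ℝ := (c • (a - p)) i with hx
  -- moving the `i`-th coordinate of `p` by `s`
  have hsum : ∀ s : ℝ, ∑ j, |(p + s • EuclideanSpace.single i (1 : ℝ)) j| =
      ∑ j, |p j| + (|p i + s| - |p i|) := fun s => by
    rw [← sub_eq_iff_eq_add', ← Finset.sum_sub_distrib, Finset.sum_eq_single i]
    · simp
    · intro j _ hj
      simp [hj]
    · simp
  have h1 : ∀ s : ℝ, 0 ≤ lam * (|p i + s| - |p i|) - x * s + c / 2 * s ^ 2 := fun s => by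
    have := h (Set.mem_univ (p + s • EuclideanSpace.single i (1 : ℝ)))
    simp only [Set.mem_ofPred_eq, fusedLasso_zero] at this
    rw [hsum s, add_sub_right_comm, norm_add_sq_real, real_inner_smul_right, norm_smul,
      EuclideanSpace.inner_single_right] at this
    simp only [hx, PiLp.smul_apply, PiLp.sub_apply, smul_eq_mul, PiLp.norm_single,
      norm_one, mul_one, Real.norm_eq_abs, sq_abs, conj_trivial, one_mul] at this ⊢
    nlinarith
  -- convexity of `|·|` removes the quadratic term
  have h2 : ∀ s : ℝ, x * s ≤ lam * (|p i + s| - |p i|) := fun s => by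
    by_contra! hcon
    set A := lam * (|p i + s| - |p i|) - x * s with hA
    have hA0 : A < 0 := by linarith
    have h3 : ∀ t : ℝ, 0 < t → t ≤ 1 → 0 ≤ A + t * (c / 2 * s ^ 2) := fun t ht ht1 => by
      have habs : |p i + t * s| ≤ (1 - t) * |p i| + t * |p i + s| := by
        have e : p i + t * s = (1 - t) * p i + t * (p i + s) := by ring
        rw [e]
        refine (abs_add_le _ _).trans (le_of_eq ?_)
        rw [abs_mul, abs_mul, abs_of_nonneg (sub_nonneg.2 ht1), abs_of_pos ht]
      have h4 := h1 (t * s)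
      have h5 := mul_le_mul_of_nonneg_left habs hl
      have h6 : 0 ≤ t * (A + t * (c / 2 * s ^ 2)) := by rw [hA]; nlinarith
      exact nonneg_of_mul_nonneg_right h6 ht
    have h7 : Filter.Tendsto (fun t : ℝ => A + t * (c / 2 * s ^ 2))
        (nhdsWithin 0 (Set.Ioi 0)) (nhds (A + 0 * (c / 2 * s ^ 2))) :=
      (Continuous.tendsto (by fun_prop) 0).mono_left nhdsWithin_le_nhds
    rw [zero_mul, add_zero] at h7
    refine hA0.not_ge (ge_of_tendsto h7 ?_)
    filter_upwards [Ioc_mem_nhdsGT (zero_lt_one' ℝ)] with t ht using h3 t ht.1 ht.2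
  have h8 : |x| ≤ lam := by
    have hp := h2 1
    have hm := h2 (-1)
    have e1 : |p i + 1| - |p i| ≤ 1 := by
      have := abs_add_le (p i) 1
      rw [abs_one] at this
      linarith
    have e2 : |p i + -1| - |p i| ≤ 1 := by
      have := abs_add_le (p i) (-1)
      rw [abs_neg, abs_one] at this
      linarith
    have := mul_le_mul_of_nonneg_left e1 hl
    have := mul_le_mul_of_nonneg_left e2 hl
    exact abs_le.2 ⟨by linarith, by linarith⟩
  refine ⟨h8, le_antisymm ((le_abs_self _).trans (by rw [abs_mul]; gcongr)) ?_⟩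
  have h9 := h2 (-p i)
  rw [add_neg_cancel, abs_zero] at h9
  linarith

/-- On bounded sets, the inverse of the subdifferential of `λ ‖·‖₁` is upper Lipschitz at `x₀`:
a coordinate of `z` can violate a sign condition imposed by `x₀` only if the subgradient at `z`
differs from `x₀` by a fixed amount. -/
theorem exists_upper_lipschitz (lam : ℝ) (x₀ : Vec n) (ρ : ℝ) (hρ : 0 ≤ ρ) :
    ∃ K : ℝ, 0 ≤ K ∧ ∀ x z : Vec n, ‖z‖ ≤ ρ → IsL1Subgradient lam x z → ∀ i,
      (x₀ i < lam → z i ≤ K * ‖x - x₀‖) ∧ (-lam < x₀ i → -z i ≤ K * ‖x - x₀‖) := by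
  -- every coordinate of `x₀` below `λ` or above `-λ` keeps the distance `δ` from that value
  obtain ⟨δ, hδ, hδle⟩ : ∃ δ : ℝ, 0 < δ ∧ ∀ i,
      (x₀ i < lam → δ ≤ lam - x₀ i) ∧ (-lam < x₀ i → δ ≤ x₀ i + lam) := by
    have hex : ∀ᶠ δ : ℝ in nhdsWithin 0 (Set.Ioi 0), ∀ i,
        (x₀ i < lam → δ ≤ lam - x₀ i) ∧ (-lam < x₀ i → δ ≤ x₀ i + lam) := by
      simp only [Filter.eventually_all, Filter.eventually_and]
      exact fun i => ⟨fun h => eventually_nhdsWithin_of_eventually_nhds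
        (eventually_le_nhds (sub_pos.2 h)), fun h => eventually_nhdsWithin_of_eventually_nhds
        (eventually_le_nhds (neg_lt_iff_pos_add.1 h))⟩
    obtain ⟨δ, h1, h2⟩ := (hex.and self_mem_nhdsWithin).exists
    exact ⟨δ, h2, h1⟩
  refine ⟨ρ / δ, by positivity, fun x z hz hx i => ?_⟩
  have hzi : |z i| ≤ ρ := (PiLp.norm_apply_le z i).trans hz
  have hxi : |x i - x₀ i| ≤ ‖x - x₀‖ := PiLp.norm_apply_le (x - x₀) i
  obtain ⟨hzl, hzu⟩ := abs_le.1 hzi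
  obtain ⟨hxl, hxu⟩ := abs_le.1 hxi
  obtain ⟨h1, h2, h3⟩ := isL1Subgradient_iff.1 hx i
  obtain ⟨h4, h5⟩ := abs_le.1 h1
  have hbig : δ ≤ ‖x - x₀‖ → ρ ≤ ρ / δ * ‖x - x₀‖ := fun h => by
    rw [div_mul_eq_mul_div, le_div_iff₀ hδ]
    gcongr
  have hnn : 0 ≤ ρ / δ * ‖x - x₀‖ := by positivity
  refine ⟨fun hlt => ?_, fun hlt => ?_⟩
  · by_cases h : x i < lam
    · exact (h2 h).trans hnn
    · exact hzu.trans (hbig (by linarith [(hδle i).1 hlt]))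
  · by_cases h : -lam < x i
    · linarith [h3 h]
    · have := hbig (by linarith [(hδle i).2 hlt])
      linarith

end L1

/-! ### Components of primal-dual points -/

section Coordinates

variable {n : ℕ}

theorem Pt.y_eq (u : Pt n) : u.y = u.yt.fst := rfl

theorem Pt.yt_sub (u w : Pt n) : (u - w).yt = u.yt - w.yt := rfl

theorem Pt.y_sub (u w : Pt n) : (u - w).y = u.y - w.y := rfl

theorem Pt.z_sub (u w : Pt n) : (u - w).z = u.z - w.z := rfl

theorem Pt.x_sub (u w : Pt n) : (u - w).x = u.x - w.x := rfl

theorem Pt.norm_sq (u : Pt n) : ‖u‖ ^ 2 = ‖u.yt‖ ^ 2 + ‖u.z‖ ^ 2 + ‖u.x‖ ^ 2 := by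
  rw [WithLp.prod_norm_sq_eq_of_L2, WithLp.prod_norm_sq_eq_of_L2 u.snd, add_assoc]
  rfl

theorem Pt.norm_yt_le (u : Pt n) : ‖u.yt‖ ≤ ‖u‖ :=
  WithLp.norm_fst_le _ u

theorem Pt.norm_y_le (u : Pt n) : ‖u.y‖ ≤ ‖u‖ :=
  (WithLp.norm_fst_le _ u.yt).trans u.norm_yt_le

theorem Pt.norm_z_le (u : Pt n) : ‖u.z‖ ≤ ‖u‖ :=
  (WithLp.norm_fst_le _ u.snd).trans (WithLp.norm_snd_le _ u)

theorem Pt.norm_x_le (u : Pt n) : ‖u.x‖ ≤ ‖u‖ :=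
  (WithLp.norm_snd_le _ u.snd).trans (WithLp.norm_snd_le _ u)

theorem Pt.norm_le (u : Pt n) : ‖u‖ ≤ ‖u.yt‖ + ‖u.z‖ + ‖u.x‖ := by
  refine le_of_sq_le_sq ?_ (by positivity)
  rw [u.norm_sq]
  have : 0 ≤ ‖u.yt‖ * ‖u.z‖ + ‖u.yt‖ * ‖u.x‖ + ‖u.z‖ * ‖u.x‖ := by positivity
  nlinarith

theorem inner_ext_zero (x : Vec n) (d : Ext n) : ⟪ext x 0, d⟫_ℝ = ⟪x, d.fst⟫_ℝ := by
  simp [ext, WithLp.prod_inner_apply]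

theorem norm_ext_zero (x : Vec n) : ‖ext x 0‖ = ‖x‖ := by simp [ext]

end Coordinates

/-! ### The KKT conditions -/

section KKT

variable {n N : ℕ} {f : Ext n → ℝ} {lam : ℝ}

/-- Minimizing `λ ‖·‖₁ + ½ ‖· - (x + z)‖²` at `z` means that `x` is a subgradient at `z`. -/
theorem mem_kktSet_iff (hl : 0 ≤ lam) {u : Pt n} : u ∈ kktSet f (fusedLasso lam 0) ↔
    ∇ f u.yt + ext u.x 0 = 0 ∧ IsL1Subgradient lam u.x u.z ∧ u.y = u.z := by
  refine and_congr_right fun _ => and_congr ⟨fun h => ?_, fun h => ?_⟩ sub_eq_zero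
  · have := isL1Subgradient_of_isMinOn hl h
    rwa [add_sub_cancel_right, one_smul] at this
  · intro w _
    have h1 := h.add_inner_le w
    have e : w - (u.x + u.z) = (w - u.z) - u.x := by abel
    have e' : u.z - (u.x + u.z) = -u.x := by abel
    simp only [Set.mem_ofPred_eq]
    rw [e, e', norm_neg, norm_sub_sq_real, real_inner_comm]
    nlinarith [sq_nonneg ‖w - u.z‖]

theorem isClosed_kktSet (hl : 0 ≤ lam) (hf : Continuous fun v => ∇ f v) :
    IsClosed (kktSet f (fusedLasso lam 0) : Set (Pt n)) := by
  have h1 : Continuous (Pt.yt : Pt n → Ext n) := by unfold Pt.yt; fun_prop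
  have h2 : Continuous (Pt.y : Pt n → Vec n) := by unfold Pt.y; fun_prop
  have h3 : Continuous (Pt.z : Pt n → Vec n) := by unfold Pt.z; fun_prop
  have h4 : Continuous (Pt.x : Pt n → Vec n) := by unfold Pt.x; fun_prop
  have h5 : Continuous fun u : Pt n => ext u.x 0 := by unfold ext; fun_prop
  have h6 : Continuous fun u : Pt n => ∇ f u.yt := hf.comp h1
  have e : (kktSet f (fusedLasso lam 0) : Set (Pt n)) =
      {u | ∇ f u.yt + ext u.x 0 = 0} ∩ ({u | IsL1Subgradient lam u.x u.z} ∩ {u | u.y = u.z}) :=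
    Set.ext fun u => mem_kktSet_iff hl
  rw [e]
  refine (isClosed_eq (by fun_prop) continuous_const).inter
    (IsClosed.inter ?_ (isClosed_eq h2 h3))
  simp only [IsL1Subgradient, Set.ofPred_forall, Set.ofPred_and]
  exact isClosed_iInter fun i => (isClosed_le (by fun_prop) continuous_const).inter
    (isClosed_eq (by fun_prop) (by fun_prop))

/-- Pairing the perturbed optimality conditions at `u` with the exact ones at a KKT point `w`:
since the subdifferential of `λ ‖·‖₁` is monotone, only the residuals remain. -/
theorem inner_gradient_sub_le_of_mem_kktSet (hl : 0 ≤ lam) {u w : Pt n} {x : Vec n} {R : ℝ}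
    (hw : w ∈ kktSet f (fusedLasso lam 0)) (h1 : ‖∇ f u.yt + ext u.x 0‖ ≤ R)
    (hx : IsL1Subgradient lam x u.z) (h2 : ‖x - u.x‖ ≤ R) (h3 : ‖u.y - u.z‖ ≤ R) :
    ⟪∇ f u.yt - ∇ f w.yt, u.yt - w.yt⟫_ℝ ≤ 3 * R * ‖u - w‖ := by
  obtain ⟨hw1, hw2, hw3⟩ := (mem_kktSet_iff hl).1 hw
  have hmono := hx.inner_sub_nonneg hw2
  have e : ⟪∇ f u.yt - ∇ f w.yt, u.yt - w.yt⟫_ℝ =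
      ⟪∇ f u.yt + ext u.x 0, (u - w).yt⟫_ℝ - ⟪(u - w).x, u.y - u.z⟫_ℝ
        - ⟪x - w.x, u.z - w.z⟫_ℝ + ⟪x - u.x, (u - w).z⟫_ℝ := by
    have ew : ⟪∇ f w.yt, u.yt - w.yt⟫_ℝ = -⟪w.x, u.y - w.y⟫_ℝ := by
      rw [eq_neg_of_add_eq_zero_left hw1, inner_neg_left, inner_ext_zero]
      rfl
    rw [inner_sub_left, ew, inner_add_left, inner_ext_zero, Pt.yt_sub, Pt.x_sub, Pt.z_sub,
      WithLp.sub_fst, ← Pt.y_eq, ← Pt.y_eq, hw3]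
    simp only [inner_sub_left, inner_sub_right]
    ring
  have hR : 0 ≤ R := (norm_nonneg _).trans h3
  have b1 := (real_inner_le_norm (∇ f u.yt + ext u.x 0) (u - w).yt).trans
    (mul_le_mul h1 (u - w).norm_yt_le (norm_nonneg _) hR)
  have b2 := (neg_le_of_abs_le ((abs_real_inner_le_norm (u - w).x (u.y - u.z)).trans
    (mul_le_mul (u - w).norm_x_le h3 (norm_nonneg _) (norm_nonneg _))))
  have b3 := (real_inner_le_norm (x - u.x) (u - w).z).trans
    (mul_le_mul h2 (u - w).norm_z_le (norm_nonneg _) hR)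
  rw [e]
  linarith

end KKT

/-! ### The error bound for the KKT set -/

section ErrorBound

variable {n N : ℕ} {B : Fin N → Vec n} {b : Fin N → ℝ} {lam : ℝ}

/-- The values `⟪Aᵢ, ỹ⟫` and the multiplier are the same at all KKT points. -/
theorem eq_of_mem_kktSet (hN : 0 < N) (hl : 0 ≤ lam) {u w : Pt n}
    (hu : u ∈ kktSet (loss B b) (fusedLasso lam 0))
    (hw : w ∈ kktSet (loss B b) (fusedLasso lam 0)) :
    (∀ i, ⟪dataVec B b i, u.yt⟫_ℝ = ⟪dataVec B b i, w.yt⟫_ℝ) ∧ u.x = w.x := by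
  obtain ⟨hu1, hu2, hu3⟩ := (mem_kktSet_iff hl).1 hu
  obtain ⟨hw1, -, -⟩ := (mem_kktSet_iff hl).1 hw
  obtain ⟨m, hm, hmle⟩ := exists_mul_sq_le_inner_gradient_loss B b hN (max ‖u.yt‖ ‖w.yt‖)
  have h1 := inner_gradient_sub_le_of_mem_kktSet hl (R := 0) hw (by rw [hu1, norm_zero]) hu2
    (by simp) (by simp [hu3])
  have h2 : ∀ i, ⟪dataVec B b i, u.yt⟫_ℝ = ⟪dataVec B b i, w.yt⟫_ℝ := fun i => by
    have h3 := hmle u.yt w.yt (le_max_left _ _) (le_max_right _ _) i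
    have h4 : ⟪dataVec B b i, u.yt - w.yt⟫_ℝ ^ 2 ≤ 0 :=
      nonpos_of_mul_nonpos_right (h3.trans (h1.trans_eq (by ring))) hm
    rw [← sub_eq_zero, ← inner_sub_right]
    exact pow_eq_zero_iff two_ne_zero |>.1 (le_antisymm h4 (sq_nonneg _))
  refine ⟨h2, ?_⟩
  have h3 : ext u.x 0 = ext w.x 0 := by
    rw [eq_neg_of_add_eq_zero_right hu1, eq_neg_of_add_eq_zero_right hw1, gradient_loss,
      gradient_loss]
    simp only [h2]
  exact congrArg WithLp.fst h3

/-- **Hoffman's bound for the KKT set.** Given a KKT point `w`, every `(p, p.fst, w.x)` such that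
`⟪Aᵢ, p⟫ = ⟪Aᵢ, w.yt⟫` and the coordinates of `p.fst` obey the sign conditions that `w.x` imposes
is a KKT point too. These `p` form a polyhedron, to which `hoffman` applies. -/
theorem exists_kkt_near (hl : 0 ≤ lam) {w : Pt n}
    (hw : w ∈ kktSet (loss B b) (fusedLasso lam 0)) :
    ∃ κ : ℝ, 0 ≤ κ ∧ ∀ (v : Ext n) (ε : ℝ), 0 ≤ ε →
      (∀ i, |⟪dataVec B b i, v - w.yt⟫_ℝ| ≤ ε) →
      (∀ i, (w.x i < lam → v.fst i ≤ ε) ∧ (-lam < w.x i → -v.fst i ≤ ε)) →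
      ∃ w' ∈ kktSet (loss B b) (fusedLasso lam 0),
        w'.y = w'.z ∧ w'.x = w.x ∧ ‖v - w'.yt‖ ≤ κ * ε := by
  classical
  obtain ⟨hw1, hw2, hw3⟩ := (mem_kktSet_iff hl).1 hw
  have hw4 := isL1Subgradient_iff.1 hw2
  set A := dataVec B b with hA
  set e : Fin n → Ext n := fun i => ext (EuclideanSpace.single i 1) 0 with he
  have hei : ∀ i v, ⟪e i, v⟫_ℝ = v.fst i := fun i v => by
    rw [he, inner_ext_zero, EuclideanSpace.inner_single_left]
    simp
  set a : (Fin N ⊕ Fin N) ⊕ (Fin n ⊕ Fin n) → Ext n :=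
    Sum.elim (Sum.elim A (fun i => -A i))
      (Sum.elim (fun i => if w.x i < lam then e i else 0)
        (fun i => if -lam < w.x i then -e i else 0)) with ha
  set c : (Fin N ⊕ Fin N) ⊕ (Fin n ⊕ Fin n) → ℝ :=
    Sum.elim (Sum.elim (fun i => ⟪A i, w.yt⟫_ℝ) (fun i => -⟪A i, w.yt⟫_ℝ))
      (Sum.elim (fun _ => 0) (fun _ => 0)) with hc
  have hpoly : ∀ (v : Ext n) (ε : ℝ), 0 ≤ ε → ((∀ j, ⟪a j, v⟫_ℝ ≤ c j + ε) ↔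
      (∀ i, |⟪A i, v - w.yt⟫_ℝ| ≤ ε) ∧
      (∀ i, (w.x i < lam → v.fst i ≤ ε) ∧ (-lam < w.x i → -v.fst i ≤ ε))) := by
    intro v ε hε
    simp only [Sum.forall, ha, hc, Sum.elim_inl, Sum.elim_inr, inner_neg_left, ← forall_and]
    refine and_congr (forall_congr' fun i => ?_) (forall_congr' fun i => and_congr ?_ ?_)
    · rw [abs_le, inner_sub_right]
      constructor <;> rintro ⟨h1, h2⟩ <;> constructor <;> linarith
    · split_ifs with h <;> simp [h, hei, hε]
    · split_ifs with h <;> simp [h, hei, hε]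
  obtain ⟨κ, hκ, hoff⟩ := hoffman a
  have hne : ∃ v, ∀ j, ⟪a j, v⟫_ℝ ≤ c j := by
    refine ⟨w.yt, ?_⟩
    simpa using (hpoly w.yt 0 le_rfl).2 ⟨by simp, fun i => by
      rw [← Pt.y_eq, hw3]
      exact ⟨fun h => (hw4 i).2.1 h, fun h => neg_nonpos.2 ((hw4 i).2.2 h)⟩⟩
  refine ⟨κ, hκ, fun v ε hε h1 h2 => ?_⟩
  obtain ⟨p, hp, hvp⟩ := hoff c hne v ε hε ((hpoly v ε hε).2 ⟨h1, h2⟩)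
  obtain ⟨hp1, hp2⟩ := (hpoly p 0 le_rfl).1 (by simpa using hp)
  refine ⟨WithLp.toLp 2 (p, WithLp.toLp 2 (p.fst, w.x)), ?_, rfl, rfl, hvp⟩
  have hgrad : ∇ (loss B b) p = ∇ (loss B b) w.yt := by
    have : ∀ i, ⟪dataVec B b i, p⟫_ℝ = ⟪dataVec B b i, w.yt⟫_ℝ := fun i => by
      rw [← sub_eq_zero, ← inner_sub_right]
      exact abs_nonpos_iff.1 (hp1 i)
    rw [gradient_loss, gradient_loss]
    simp only [this]
  refine (mem_kktSet_iff hl).2 ⟨?_, isL1Subgradient_iff.2 fun i =>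
    ⟨(hw4 i).1, (hp2 i).1, fun h => neg_nonpos.1 ((hp2 i).2 h)⟩, rfl⟩
  change ∇ (loss B b) p + ext w.x 0 = 0
  rw [hgrad, hw1]

/-- **Error bound.** On bounded sets, the distance to the KKT set is at most a constant times the
residual of the optimality conditions. -/
theorem exists_error_bound (hN : 0 < N) (hl : 0 ≤ lam)
    (hne : (kktSet (loss B b) (fusedLasso lam 0)).Nonempty) (ρ : ℝ) :
    ∃ K : ℝ, 0 ≤ K ∧ ∀ (u : Pt n) (x : Vec n) (R : ℝ), ‖u‖ ≤ ρ →
      ‖∇ (loss B b) u.yt + ext u.x 0‖ ≤ R → IsL1Subgradient lam x u.z → ‖x - u.x‖ ≤ R →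
      ‖u.y - u.z‖ ≤ R → ∃ w ∈ kktSet (loss B b) (fusedLasso lam 0), ‖u - w‖ ≤ K * R := by
  obtain ⟨w₀, hw₀⟩ := hne
  obtain ⟨m, hm, hmle⟩ := exists_mul_sq_le_inner_gradient_loss B b hN (2 * ρ + ‖w₀‖)
  obtain ⟨L, hL, hLle⟩ := exists_norm_gradient_loss_sub_le B b
  obtain ⟨K, hK, hKle⟩ := exists_upper_lipschitz lam w₀.x (max ρ 0) (le_max_right _ _)
  obtain ⟨κ, hκ, hκle⟩ := exists_kkt_near hl hw₀
  -- the distance will be bounded by `c₁ R + c₂ ε`, where `m ε² = 3 R d` and `d` is the distance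
  set c₁ : ℝ := 2 * κ * (2 * K + 1) + 2 with hc₁
  set c₂ : ℝ := 2 * κ * (1 + K * L) + L with hc₂
  have hc₁0 : 0 ≤ c₁ := by positivity
  have hc₂0 : 0 ≤ c₂ := by positivity
  refine ⟨2 * c₁ + 3 * c₂ ^ 2 / m, by positivity, fun u x R hu h1 hx h2 h3 => ?_⟩
  have hR : 0 ≤ R := (norm_nonneg _).trans h3
  obtain ⟨w, hw, hdist⟩ := (isClosed_kktSet hl (continuous_gradient_loss B b)).exists_infDist_eq_dist
    ⟨w₀, hw₀⟩ u
  have hnear : ∀ w' ∈ kktSet (loss B b) (fusedLasso lam 0), ‖u - w‖ ≤ ‖u - w'‖ := fun w' hw' => by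
    rw [← dist_eq_norm, ← dist_eq_norm, ← hdist]
    exact Metric.infDist_le_dist_of_mem hw'
  refine ⟨w, hw, ?_⟩
  obtain ⟨hAw, hxw⟩ := eq_of_mem_kktSet hN hl hw hw₀
  obtain ⟨hw1, -, -⟩ := (mem_kktSet_iff hl).1 hw
  set d := ‖u - w‖ with hd
  have hd0 : 0 ≤ d := norm_nonneg _
  set ε := √(3 * R * d / m) with hε
  have hε0 : 0 ≤ ε := Real.sqrt_nonneg _
  have hεsq : ε ^ 2 = 3 * R * d / m := Real.sq_sqrt (by positivity)
  have hρ0 : 0 ≤ ρ := (norm_nonneg u).trans hu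
  have hwb : ‖w‖ ≤ 2 * ρ + ‖w₀‖ := by
    have e : ‖w‖ ≤ ‖u‖ + ‖u - w‖ := by
      simpa using norm_sub_le u (u - w)
    have := hnear w₀ hw₀
    have := norm_sub_le u w₀
    linarith
  have hA : ∀ i, |⟪dataVec B b i, u.yt - w.yt⟫_ℝ| ≤ ε := fun i => by
    refine Real.abs_le_sqrt ?_
    rw [le_div_iff₀ hm, mul_comm]
    refine (hmle u.yt w.yt (u.norm_yt_le.trans ?_) (w.norm_yt_le.trans hwb) i).trans
      (inner_gradient_sub_le_of_mem_kktSet hl hw h1 hx h2 h3)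
    linarith [norm_nonneg w₀]
  have hxd : ‖u.x - w₀.x‖ ≤ R + L * ε := by
    have e : ext (u.x - w₀.x) 0 = (∇ (loss B b) u.yt + ext u.x 0)
        - (∇ (loss B b) u.yt - ∇ (loss B b) w.yt) := by
      rw [eq_neg_of_add_eq_zero_left hw1, hxw]
      have : ext (u.x - w₀.x) 0 = ext u.x 0 - ext w₀.x 0 := by
        simp [ext, ← WithLp.toLp_sub]
      rw [this]
      abel
    rw [← norm_ext_zero, e]
    exact (norm_sub_le _ _).trans (add_le_add h1 (hLle _ _ _ hA))
  have hxd' : ‖x - w₀.x‖ ≤ 2 * R + L * ε := by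
    have := norm_sub_le_norm_sub_add_norm_sub x u.x w₀.x
    linarith
  have hKx : K * ‖x - w₀.x‖ ≤ K * (2 * R + L * ε) := mul_le_mul_of_nonneg_left hxd' hK
  have hviol := hKle x u.z ((u.norm_z_le.trans hu).trans (le_max_left _ _)) hx
  have hyz : ∀ i, |u.y i - u.z i| ≤ R := fun i =>
    (PiLp.norm_apply_le (u.y - u.z) i).trans h3
  have hKR : 0 ≤ K * (2 * R + L * ε) := by positivity
  obtain ⟨w', hw', hw'yz, hw'x, hw'd⟩ := hκle u.yt (ε + K * (2 * R + L * ε) + R) (by positivity)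
    (fun i => by
      rw [inner_sub_right, ← hAw i, ← inner_sub_right]
      linarith [hA i]) (fun i => by
      obtain ⟨h4, h5⟩ := hviol i
      obtain ⟨h6, h7⟩ := abs_le.1 (hyz i)
      rw [← Pt.y_eq]
      exact ⟨fun h => by linarith [h4 h], fun h => by linarith [h5 h]⟩)
  have hz : ‖u.z - w'.z‖ ≤ R + ‖u.yt - w'.yt‖ := by
    have e : u.z - w'.z = -(u.y - u.z) + (u.yt - w'.yt).fst := by
      rw [← hw'yz, WithLp.sub_fst, ← Pt.y_eq, ← Pt.y_eq]
      abel
    rw [e]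
    refine (norm_add_le _ _).trans ?_
    rw [norm_neg]
    exact add_le_add h3 (WithLp.norm_fst_le _ _)
  have hdle : d ≤ c₁ * R + c₂ * ε := by
    have h4 := (hnear w' hw').trans (u - w').norm_le
    rw [Pt.yt_sub, Pt.z_sub, Pt.x_sub, hw'x] at h4
    rw [hc₁, hc₂]
    linarith
  have hamgm : c₂ * ε ≤ (3 * c₂ ^ 2 / m * R + d) / 2 := by
    refine le_of_sq_le_sq ?_ (by positivity)
    have e : (c₂ * ε) ^ 2 = 3 * c₂ ^ 2 / m * R * d := by
      rw [mul_pow, hεsq]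
      ring
    rw [e]
    nlinarith [sq_nonneg (3 * c₂ ^ 2 / m * R - d)]
  linarith

end ErrorBound

/-! ### The operators of the `ỹ`-step -/

section Operators

variable {n : ℕ} {Sig : Ext n →L[ℝ] Ext n}

theorem inner_proxTerm (Sig : Ext n →L[ℝ] Ext n) (sig r : ℝ) (d v : Ext n) :
    ⟪d, proxTerm Sig sig r v⟫_ℝ = -(1 / 2) * ⟪d, Sig v⟫_ℝ + sig * r * (d.snd * v.snd) := by
  have h : ∀ v : Ext n, ⟪ext (0 : Vec n) 1, v⟫_ℝ = v.snd := fun v => by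
    simp [ext, WithLp.prod_inner_apply]
  have h' : ⟪d, ext (0 : Vec n) 1⟫_ℝ = d.snd := by rw [real_inner_comm, h]
  simp only [proxTerm, diagZero, add_apply, neg_apply, smul_apply,
    InnerProductSpace.rankOne_apply, inner_add_right, inner_neg_right,
    real_inner_smul_right, h, h']
  ring

theorem normSq_add_proxTerm (Sig : Ext n →L[ℝ] Ext n) (sig r : ℝ) (v : Ext n) :
    normSq (Sig + proxTerm Sig sig r) v = (1 / 2) * normSq Sig v + sig * r * v.snd ^ 2 := by
  rw [normSq, add_apply, inner_add_right, inner_proxTerm, normSq]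
  ring

theorem normSq_nonneg (hSig : Sig.IsPositive) (v : Ext n) : 0 ≤ normSq Sig v := by
  rw [normSq, real_inner_comm]
  exact hSig.re_inner_nonneg_left v

theorem inner_apply_comm (hSig : Sig.IsPositive) (v w : Ext n) :
    ⟪v, Sig w⟫_ℝ = ⟪w, Sig v⟫_ℝ := by
  rw [real_inner_comm]
  exact hSig.isSymmetric w v

theorem normSq_le (Sig : Ext n →L[ℝ] Ext n) (v : Ext n) : normSq Sig v ≤ ‖Sig‖ * ‖v‖ ^ 2 := by
  refine (real_inner_le_norm _ _).trans ?_
  have := mul_le_mul_of_nonneg_left (Sig.le_opNorm v) (norm_nonneg v)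
  linarith

theorem Ext.norm_sq (v : Ext n) : ‖v‖ ^ 2 = ‖v.fst‖ ^ 2 + v.snd ^ 2 := by
  simp [WithLp.prod_norm_sq_eq_of_L2]

end Operators

/-! ### The step length condition -/

section StepLength

/-- The weight `s_τ` turns the cross term `⟨r', Δz⟩` of two consecutive constraint residuals
into a telescoping sum, with a positive remainder as long as `1 + τ - τ² > 0`. Here `a`, `ρ`,
`ρ'` stand for `‖Δz‖²`, `‖r‖²`, `‖r'‖²`, and `c`, `c'` for `⟨r, Δz⟩`, `⟨r', Δz⟩`. -/
theorem exists_le_sTau_combination {tau : ℝ} (htau : 0 < tau) (htau' : tau < (1 + √5) / 2) :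
    0 < sTau tau ∧ ∃ θ : ℝ, 0 < θ ∧ ∀ a ρ ρ' c c' : ℝ, 0 ≤ a → 0 ≤ ρ → 0 ≤ ρ' →
      (1 - tau) * c' ≤ c → (∀ t : ℝ, 0 ≤ a + 2 * t * c' + t ^ 2 * ρ') →
      θ * (a + ρ + ρ') ≤ a + (2 - tau) * ρ + 2 * c + sTau tau * (ρ' - ρ) := by
  have h5 : √5 ^ 2 = 5 := Real.sq_sqrt (by norm_num)
  have hgold : 0 < 1 + tau - tau ^ 2 := by
    have h1 : 1 < √5 := Real.lt_sqrt_of_sq_lt (by norm_num)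
    have h2 : 0 < tau - (1 - √5) / 2 := by linarith
    nlinarith [mul_pos (sub_pos.2 htau') h2]
  have hinv : 0 < tau⁻¹ := inv_pos.2 htau
  have hinv1 : tau * tau⁻¹ = 1 := mul_inv_cancel₀ htau.ne'
  rcases le_total tau 1 with h1 | h1
  · have hs : sTau tau = 5 / 4 - tau := by
      rw [sTau, min_eq_left (h1.trans (one_le_inv_iff₀.2 ⟨htau, h1⟩))]
      ring
    rw [hs]
    refine ⟨by linarith, min tau (1 / 4), by positivity, fun a ρ ρ' c c' ha hρ hρ' hc hq => ?_⟩
    have h2 := mul_nonneg (sub_nonneg.2 h1) (hq 1)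
    have h3 := mul_le_mul_of_nonneg_right (min_le_left tau (1 / 4)) ha
    have h4 := mul_le_mul_of_nonneg_right (min_le_right tau (1 / 4)) hρ
    have h5 := mul_le_mul_of_nonneg_right (min_le_right tau (1 / 4)) hρ'
    linarith
  · have hs : sTau tau = (5 - tau - 3 * tau⁻¹) / 4 := by
      rw [sTau, min_eq_right ((inv_le_one_of_one_le₀ h1).trans h1)]
    set η := (1 - tau + tau⁻¹) / 4 with hη
    have hη0 : 0 < η := by
      have : tau⁻¹ * (1 + tau - tau ^ 2) = 1 - tau + tau⁻¹ := by linear_combination (1 - tau) * hinv1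
      have := mul_pos hinv hgold
      rw [hη]; linarith
    have hinvle : tau⁻¹ ≤ 1 := inv_le_one_of_one_le₀ h1
    rw [hs]
    refine ⟨by linarith, min (1 + tau - tau ^ 2) η, by positivity,
      fun a ρ ρ' c c' ha hρ hρ' hc hq => ?_⟩
    -- Young's inequality with weight `τ`
    have h2 := mul_nonneg (mul_nonneg (sub_nonneg.2 h1) htau.le) (hq (-tau⁻¹))
    have e : (tau - 1) * tau * (a + 2 * -tau⁻¹ * c' + (-tau⁻¹) ^ 2 * ρ') =
        (tau ^ 2 - tau) * a - 2 * (tau - 1) * c' + (1 - tau⁻¹) * ρ' := by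
      linear_combination (-2 * (tau - 1) * c' + (tau - 1) * tau⁻¹ * ρ' + ρ') * hinv1
    rw [e] at h2
    have h3 := mul_le_mul_of_nonneg_right (min_le_left (1 + tau - tau ^ 2) η) ha
    have h4 := mul_le_mul_of_nonneg_right (min_le_right (1 + tau - tau ^ 2) η) hρ
    have h5 := mul_le_mul_of_nonneg_right (min_le_right (1 + tau - tau ^ 2) η) hρ'
    have h6 := mul_nonneg hη0.le hρ
    have e2 : 2 - tau = (5 - tau - 3 * tau⁻¹) / 4 + 3 * η := by rw [hη]; ring
    have e3 : (5 - tau - 3 * tau⁻¹) / 4 = 1 - tau⁻¹ + η := by rw [hη]; ring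
    rw [e2, e3]
    nlinarith

end StepLength

/-! ### The optimality conditions of the subproblems -/

section Steps

variable {n : ℕ} {f : Ext n → ℝ} {φ : Vec n → ℝ} {Sig : Ext n →L[ℝ] Ext n} {sig tau r lam : ℝ}
  {u : ℕ → Pt n}

theorem eq_zero_of_forall_nonneg_quadratic {L Q : ℝ} (h : ∀ t : ℝ, 0 ≤ t * L + t ^ 2 * Q) :
    L = 0 := by
  have := discrim_le_zero (a := Q) (b := L) (c := 0) fun t => by linarith [h t, sq t]
  rw [discrim] at this
  nlinarith [sq_nonneg L]

/-- The optimality condition of the `ỹ`-step, tested against a direction `d`. -/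
theorem IsIPADMM.stationary (hSig : Sig.IsPositive)
    (hu : IsIPADMM f φ Sig (proxTerm Sig sig r) sig tau u) (k : ℕ) (d : Ext n) :
    ⟪∇ f (u k).yt, d⟫_ℝ + (1 / 2) * ⟪d, Sig ((u (k + 1)).yt - (u k).yt)⟫_ℝ
      + sig * r * (d.snd * ((u (k + 1)).yt - (u k).yt).snd)
      + ⟪d.fst, (u k).x + sig • ((u (k + 1)).y - (u k).z)⟫_ℝ = 0 := by
  have hmin := (hu k).1
  set v := (u k).yt
  set p := (u (k + 1)).yt with hp
  refine eq_zero_of_forall_nonneg_quadratic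
    (Q := (1 / 4) * normSq Sig d + sig * r / 2 * d.snd ^ 2 + sig / 2 * ‖d.fst‖ ^ 2) fun t => ?_
  have h := hmin (Set.mem_univ (p + t • d))
  have e : p + t • d - v = (p - v) + t • d := by abel
  have e' : (p + t • d).fst - (u k).z = (p.fst - (u k).z) + t • d.fst := by
    rw [WithLp.add_fst, WithLp.smul_fst]; abel
  have e2 : ‖(p.fst - (u k).z) + t • d.fst‖ ^ 2 = ‖p.fst - (u k).z‖ ^ 2
      + 2 * (t * ⟪d.fst, p.fst - (u k).z⟫_ℝ) + t ^ 2 * ‖d.fst‖ ^ 2 := by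
    rw [norm_add_sq_real, real_inner_smul_right, norm_smul, real_inner_comm, mul_pow,
      Real.norm_eq_abs, sq_abs]
  have e3 : ⟪p - v, Sig d⟫_ℝ = ⟪d, Sig (p - v)⟫_ℝ := inner_apply_comm hSig _ _
  simp only [Set.mem_ofPred_eq, majAugLag, model, normSq, inner_proxTerm, e, e', e2, map_add,
    map_smul, inner_add_left, inner_add_right, real_inner_smul_left, real_inner_smul_right, e3,
    WithLp.add_snd, WithLp.smul_snd, smul_eq_mul] at h
  simp only [normSq, Pt.y_eq, ← hp, inner_add_right, real_inner_smul_right]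
  linarith

/-- The optimality condition of the `z`-step. -/
theorem IsIPADMM.isL1Subgradient (hl : 0 ≤ lam) (hsig : 0 < sig) {S : Ext n →L[ℝ] Ext n}
    (hu : IsIPADMM f (fusedLasso lam 0) Sig S sig tau u) (k : ℕ) :
    IsL1Subgradient lam ((u k).x + sig • ((u (k + 1)).y - (u (k + 1)).z)) (u (k + 1)).z := by
  have h := isL1Subgradient_of_isMinOn hl (hu k).2.1
  have e : sig • ((u (k + 1)).y + (1 / sig) • (u k).x - (u (k + 1)).z) =
      (u k).x + sig • ((u (k + 1)).y - (u (k + 1)).z) := by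
    rw [add_sub_right_comm, smul_add, smul_smul, mul_one_div_cancel hsig.ne', one_smul, add_comm]
  rwa [e] at h

end Steps

/-! ### Descent -/

section Descent

variable {n : ℕ} {f : Ext n → ℝ} {Sig : Ext n →L[ℝ] Ext n} {sig tau r lam : ℝ}
  {u : ℕ → Pt n}

/-- The quantities that control how far step `k → k + 1` is from being stationary: the squares of
the changes of `y₀` and `z` and of the two constraint residuals. -/
def stepSq (u : ℕ → Pt n) (k : ℕ) : ℝ :=
  ((u (k + 1)).yt - (u k).yt).snd ^ 2 + ‖(u (k + 1)).z - (u k).z‖ ^ 2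
    + ‖(u (k + 1)).y - (u (k + 1)).z‖ ^ 2 + ‖(u k).y - (u k).z‖ ^ 2

theorem stepSq_nonneg (u : ℕ → Pt n) (k : ℕ) : 0 ≤ stepSq u k := by
  unfold stepSq; positivity

/-- One step of the method. In terms of the errors relative to a KKT point `w`, the sum of the
optimality conditions of the two subproblems telescopes, up to the cross term
`⟨z⁺ - z, y⁺ - z⁺⟩`. -/
theorem IsIPADMM.one_step (hf : ∀ v v', f v' + ⟪∇ f v', v - v'⟫_ℝ ≤ f v)
    (hSig : IsMajorizer f Sig) (hl : 0 ≤ lam) (hsig : 0 < sig) (htau : 0 < tau)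
    (hu : IsIPADMM f (fusedLasso lam 0) Sig (proxTerm Sig sig r) sig tau u) (k : ℕ)
    {w : Pt n} (hw : w ∈ kktSet f (fusedLasso lam 0)) :
    normSq (Sig + proxTerm Sig sig r) (u (k + 1) - w).yt + sig * ‖(u (k + 1) - w).z‖ ^ 2
        + (tau * sig)⁻¹ * ‖(u (k + 1) - w).x‖ ^ 2
        + sig * r * ((u (k + 1)).yt - (u k).yt).snd ^ 2
        + sig * (‖(u (k + 1)).z - (u k).z‖ ^ 2
          + (2 - tau) * ‖(u (k + 1)).y - (u (k + 1)).z‖ ^ 2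
          + 2 * ⟪(u (k + 1)).z - (u k).z, (u (k + 1)).y - (u (k + 1)).z⟫_ℝ) ≤
      normSq (Sig + proxTerm Sig sig r) (u k - w).yt + sig * ‖(u k - w).z‖ ^ 2
        + (tau * sig)⁻¹ * ‖(u k - w).x‖ ^ 2 := by
  obtain ⟨hw1, hw2, hw3⟩ := (mem_kktSet_iff hl).1 hw
  have h1 := hu.stationary hSig.1 k ((u (k + 1)).yt - w.yt)
  have h2 := neg_quarter_normSq_le_inner_gradient hf hSig (u k).yt (u (k + 1)).yt w.yt
  have h3 := (hu.isL1Subgradient hl hsig k).inner_sub_nonneg hw2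
  have hx := (hu k).2.2
  simp only [normSq_add_proxTerm, Pt.yt_sub, Pt.z_sub, Pt.x_sub]
  -- errors, increments and residual
  set E := (u (k + 1)).yt - w.yt with hE
  set D := (u (k + 1)).yt - (u k).yt with hD
  set ζ := (u (k + 1)).z - w.z with hζ
  set Δ := (u (k + 1)).z - (u k).z with hΔ
  set ρ := (u (k + 1)).y - (u (k + 1)).z with hρ
  set ξ := (u k).x - w.x with hξ
  have e1 : (u k).yt - w.yt = E - D := by rw [hE, hD]; abel
  have e2 : (u k).z - w.z = ζ - Δ := by rw [hζ, hΔ]; abel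
  have e3 : (u (k + 1)).x - w.x = ξ + (tau * sig) • ρ := by rw [hx, hξ]; abel
  have e4 : E.fst = ρ + ζ := by
    rw [hE, WithLp.sub_fst, ← Pt.y_eq, ← Pt.y_eq, hw3, hρ, hζ]; abel
  have e5 : (u k).x + sig • ((u (k + 1)).y - (u k).z) = w.x + (ξ + sig • (ρ + Δ)) := by
    rw [hξ, hρ, hΔ]
    module
  have e6 : (u k).x + sig • ρ - w.x = ξ + sig • ρ := by rw [hξ]; abel
  have e7 : ⟪∇ f w.yt, E⟫_ℝ = -⟪w.x, ρ + ζ⟫_ℝ := by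
    rw [eq_neg_of_add_eq_zero_left hw1, inner_neg_left, inner_ext_zero, e4]
  have e8 : normSq Sig (E - D) = normSq Sig E - 2 * ⟪E, Sig D⟫_ℝ + normSq Sig D := by
    simp only [normSq, map_sub, inner_sub_left, inner_sub_right, inner_apply_comm hSig.1 D E]
    ring
  have hne : tau * sig ≠ 0 := by positivity
  have e9 : (tau * sig)⁻¹ * ‖ξ + (tau * sig) • ρ‖ ^ 2 =
      (tau * sig)⁻¹ * ‖ξ‖ ^ 2 + 2 * ⟪ξ, ρ⟫_ℝ + tau * sig * ‖ρ‖ ^ 2 := by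
    rw [norm_add_sq_real, real_inner_smul_right, norm_smul, mul_pow, Real.norm_eq_abs, sq_abs]
    field_simp
  rw [e6] at h3
  rw [e5, e4] at h1
  rw [inner_sub_left, e7] at h2
  rw [e1, e2, e3, e8, e9, norm_sub_sq_real ζ Δ, WithLp.sub_snd E D]
  have c1 : ⟪ρ + ζ, w.x + (ξ + sig • (ρ + Δ))⟫_ℝ = ⟪w.x, ρ + ζ⟫_ℝ + ⟪ξ, ρ⟫_ℝ + ⟪ξ, ζ⟫_ℝ
      + sig * (‖ρ‖ ^ 2 + ⟪Δ, ρ⟫_ℝ + ⟪ρ, ζ⟫_ℝ + ⟪ζ, Δ⟫_ℝ) := by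
    rw [inner_add_right, real_inner_comm]
    simp only [inner_add_left, inner_add_right, real_inner_smul_right,
      real_inner_self_eq_norm_sq, real_inner_comm ξ, real_inner_comm ρ Δ, real_inner_comm ζ ρ]
    ring
  have c2 : ⟪ξ + sig • ρ, ζ⟫_ℝ = ⟪ξ, ζ⟫_ℝ + sig * ⟪ρ, ζ⟫_ℝ := by
    rw [inner_add_left, real_inner_smul_left]
  rw [c1] at h1
  rw [c2] at h3
  linarith

/-- Monotonicity of the subdifferential, applied to two consecutive `z`-steps. -/
theorem IsIPADMM.consecutive (hl : 0 ≤ lam) (hsig : 0 < sig) {S : Ext n →L[ℝ] Ext n}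
    (hu : IsIPADMM f (fusedLasso lam 0) Sig S sig tau u) (k : ℕ) :
    (1 - tau) * ⟪(u (k + 2)).z - (u (k + 1)).z, (u (k + 1)).y - (u (k + 1)).z⟫_ℝ ≤
      ⟪(u (k + 2)).z - (u (k + 1)).z, (u (k + 2)).y - (u (k + 2)).z⟫_ℝ := by
  have h := (hu.isL1Subgradient hl hsig (k + 1)).inner_sub_nonneg (hu.isL1Subgradient hl hsig k)
  rw [(hu k).2.2] at h
  have e : (u k).x + (tau * sig) • ((u (k + 1)).y - (u (k + 1)).z)
      + sig • ((u (k + 1 + 1)).y - (u (k + 1 + 1)).z)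
      - ((u k).x + sig • ((u (k + 1)).y - (u (k + 1)).z)) =
      sig • (((u (k + 2)).y - (u (k + 2)).z) - (1 - tau) • ((u (k + 1)).y - (u (k + 1)).z)) := by
    module
  rw [e, real_inner_smul_left, inner_sub_left, real_inner_smul_left] at h
  have := nonneg_of_mul_nonneg_right h hsig
  rw [real_inner_comm, real_inner_comm ((u (k + 2)).y - (u (k + 2)).z)]
  linarith

/-- **Descent.** From the second iterate on, the distance in the `M`-norm to every KKT point
decreases by a fixed multiple of `stepSq`. -/
theorem IsIPADMM.exists_descent (hf : ∀ v v', f v' + ⟪∇ f v', v - v'⟫_ℝ ≤ f v)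
    (hSig : IsMajorizer f Sig) (hl : 0 ≤ lam) (hsig : 0 < sig) (htau : 0 < tau)
    (htau' : tau < (1 + √5) / 2) (hr : 0 < r)
    (hu : IsIPADMM f (fusedLasso lam 0) Sig (proxTerm Sig sig r) sig tau u) :
    ∃ θ : ℝ, 0 < θ ∧ ∀ k, ∀ w ∈ kktSet f (fusedLasso lam 0),
      normMSq Sig (proxTerm Sig sig r) sig tau (u (k + 2) - w) + θ * stepSq u (k + 1) ≤
        normMSq Sig (proxTerm Sig sig r) sig tau (u (k + 1) - w) := by
  obtain ⟨hs, θ, hθ, hcomb⟩ := exists_le_sTau_combination htau htau'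
  refine ⟨sig * min r θ, by positivity, fun k w hw => ?_⟩
  have hw3 := ((mem_kktSet_iff hl).1 hw).2.2
  have h1 := hu.one_step hf hSig hl hsig htau (k + 1) hw
  have h2 := hcomb (‖(u (k + 2)).z - (u (k + 1)).z‖ ^ 2) (‖(u (k + 2)).y - (u (k + 2)).z‖ ^ 2)
    (‖(u (k + 1)).y - (u (k + 1)).z‖ ^ 2) _ _ (by positivity) (by positivity) (by positivity)
    (hu.consecutive hl hsig k) fun t => by
      have : ‖((u (k + 2)).z - (u (k + 1)).z) + t • ((u (k + 1)).y - (u (k + 1)).z)‖ ^ 2 =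
          ‖(u (k + 2)).z - (u (k + 1)).z‖ ^ 2
          + 2 * t * ⟪(u (k + 2)).z - (u (k + 1)).z, (u (k + 1)).y - (u (k + 1)).z⟫_ℝ
          + t ^ 2 * ‖(u (k + 1)).y - (u (k + 1)).z‖ ^ 2 := by
        rw [norm_add_sq_real, real_inner_smul_right, norm_smul, mul_pow, Real.norm_eq_abs, sq_abs]
        ring
      rw [← this]
      positivity
  have e : ∀ v : Pt n, (v - w).y - (v - w).z = v.y - v.z := fun v => by
    rw [Pt.y_sub, Pt.z_sub, hw3]; abel
  have h3 := mul_le_mul_of_nonneg_left h2 hsig.le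
  have h4 : min r θ * stepSq u (k + 1) ≤ r * ((u (k + 2)).yt - (u (k + 1)).yt).snd ^ 2
      + θ * (‖(u (k + 2)).z - (u (k + 1)).z‖ ^ 2 + ‖(u (k + 2)).y - (u (k + 2)).z‖ ^ 2
        + ‖(u (k + 1)).y - (u (k + 1)).z‖ ^ 2) := by
    rw [stepSq, add_assoc, add_assoc, mul_add, ← add_assoc]
    exact add_le_add (mul_le_mul_of_nonneg_right (min_le_left _ _) (sq_nonneg _))
      (mul_le_mul_of_nonneg_right (min_le_right _ _) (by positivity))
  have h5 := mul_le_mul_of_nonneg_left h4 hsig.le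
  rw [normMSq, normMSq, e, e]
  linarith

/-- The `M`-norm is equivalent to the Euclidean norm. -/
theorem exists_normMSq_bounds (hSig : Sig.IsPositive) (hsig : 0 < sig) (htau : 0 < tau)
    (htau' : tau < (1 + √5) / 2) (hr : 0 < r) : ∃ c C : ℝ, 0 < c ∧ 0 < C ∧ ∀ v : Pt n,
      c * ‖v‖ ^ 2 ≤ normMSq Sig (proxTerm Sig sig r) sig tau v ∧
      normMSq Sig (proxTerm Sig sig r) sig tau v ≤ C * ‖v‖ ^ 2 := by
  have hs := (exists_le_sTau_combination htau htau').1
  set s := sTau tau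
  have hi : 0 < (tau * sig)⁻¹ := by positivity
  set α := min (sig * r) (min sig (min (tau * sig)⁻¹ (s * sig))) with hα
  have hα0 : 0 < α := by positivity
  have a1 : α ≤ sig * r := min_le_left _ _
  have a2 : α ≤ sig := (min_le_right _ _).trans (min_le_left _ _)
  have a3 : α ≤ (tau * sig)⁻¹ :=
    (min_le_right _ _).trans ((min_le_right _ _).trans (min_le_left _ _))
  have a4 : α ≤ s * sig :=
    (min_le_right _ _).trans ((min_le_right _ _).trans (min_le_right _ _))
  refine ⟨α / 3, (1 / 2) * ‖Sig‖ + sig * r + sig + (tau * sig)⁻¹ + 4 * (s * sig),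
    by positivity, by positivity, fun v => ?_⟩
  have hv := v.norm_sq
  have hyt := Ext.norm_sq v.yt
  rw [← Pt.y_eq] at hyt
  have hyz : ‖v.y - v.z‖ ^ 2 = ‖v.y‖ ^ 2 - 2 * ⟪v.y, v.z⟫_ℝ + ‖v.z‖ ^ 2 :=
    norm_sub_sq_real _ _
  have hin := abs_le.1 (abs_real_inner_le_norm v.y v.z)
  have hq := normSq_nonneg hSig v.yt
  have hq' := normSq_le Sig v.yt
  rw [normMSq, normSq_add_proxTerm]
  constructor
  · have b1 := mul_le_mul_of_nonneg_right a1 (sq_nonneg v.yt.snd)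
    have b2 := mul_le_mul_of_nonneg_right a2 (sq_nonneg ‖v.z‖)
    have b3 := mul_le_mul_of_nonneg_right a3 (sq_nonneg ‖v.x‖)
    have b4 := mul_le_mul_of_nonneg_right a4 (sq_nonneg ‖v.y - v.z‖)
    -- `‖y‖² ≤ 2 ‖y - z‖² + 2 ‖z‖²`
    have b5 : ‖v‖ ^ 2 ≤ 3 * (v.yt.snd ^ 2 + ‖v.z‖ ^ 2 + ‖v.x‖ ^ 2 + ‖v.y - v.z‖ ^ 2) := by
      have h1 : ‖v.y‖ ≤ ‖v.y - v.z‖ + ‖v.z‖ := by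
        simpa using norm_add_le (v.y - v.z) v.z
      have h2 : ‖v.y‖ ^ 2 ≤ (‖v.y - v.z‖ + ‖v.z‖) ^ 2 := by gcongr
      nlinarith [sq_nonneg (‖v.y - v.z‖ - ‖v.z‖), sq_nonneg v.yt.snd, sq_nonneg ‖v.x‖,
        sq_nonneg ‖v.y - v.z‖]
    have b6 := mul_le_mul_of_nonneg_left b5 hα0.le
    linarith
  · have d1 : ‖v.yt‖ ^ 2 ≤ ‖v‖ ^ 2 := by gcongr; exact v.norm_yt_le
    have d2 : ‖v.z‖ ^ 2 ≤ ‖v‖ ^ 2 := by gcongr; exact v.norm_z_le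
    have d3 : ‖v.x‖ ^ 2 ≤ ‖v‖ ^ 2 := by gcongr; exact v.norm_x_le
    have d4 : v.yt.snd ^ 2 ≤ ‖v‖ ^ 2 := by linarith [sq_nonneg ‖v.y‖]
    have d5 : ‖v.y - v.z‖ ^ 2 ≤ 4 * ‖v‖ ^ 2 := by
      have : ‖v.y - v.z‖ ≤ 2 * ‖v‖ := by
        linarith [norm_sub_le v.y v.z, v.norm_y_le, v.norm_z_le]
      calc ‖v.y - v.z‖ ^ 2 ≤ (2 * ‖v‖) ^ 2 := by gcongr
        _ = 4 * ‖v‖ ^ 2 := by ring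
    have f1 := mul_le_mul_of_nonneg_left d1 (norm_nonneg Sig)
    have f2 := mul_le_mul_of_nonneg_left d2 hsig.le
    have f3 := mul_le_mul_of_nonneg_left d3 hi.le
    have f4 := mul_le_mul_of_nonneg_left d4 (mul_pos hsig hr).le
    have f5 := mul_le_mul_of_nonneg_left d5 (mul_pos hs hsig).le
    linarith

end Descent

/-! ### Residuals of the iterates -/

section Residual

variable {n : ℕ} {f : Ext n → ℝ} {Sig : Ext n →L[ℝ] Ext n} {sig tau r lam : ℝ}
  {u : ℕ → Pt n}

/-- The change of the iterate and the residual of the optimality conditions at the new iterate are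
both controlled by `stepSq`. -/
theorem IsIPADMM.exists_residual_le {L : ℝ} (hL : 0 ≤ L)
    (hLip : ∀ v w, ‖∇ f v - ∇ f w‖ ≤ L * ‖v - w‖) (hSig : Sig.IsPositive) (hl : 0 ≤ lam)
    (hsig : 0 < sig) (htau : 0 < tau) (hr : 0 < r)
    (hu : IsIPADMM f (fusedLasso lam 0) Sig (proxTerm Sig sig r) sig tau u) :
    ∃ C : ℝ, 0 ≤ C ∧ ∀ k, ‖u (k + 1) - u k‖ ≤ C * √(stepSq u k) ∧
      ‖∇ f (u (k + 1)).yt + ext (u (k + 1)).x 0‖ ≤ C * √(stepSq u k) ∧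
      ‖(u (k + 1)).y - (u (k + 1)).z‖ ≤ C * √(stepSq u k) ∧
      ∃ x, IsL1Subgradient lam x (u (k + 1)).z ∧ ‖x - (u (k + 1)).x‖ ≤ C * √(stepSq u k) := by
  refine ⟨5 + tau * sig + 4 * L + 2 * ‖Sig‖ + sig * r + 2 * sig, by positivity, fun k => ?_⟩
  set C := 5 + tau * sig + 4 * L + 2 * ‖Sig‖ + sig * r + 2 * sig with hC
  set δ := √(stepSq u k) with hδ
  have hδ0 : 0 ≤ δ := Real.sqrt_nonneg _
  set D := (u (k + 1)).yt - (u k).yt with hD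
  set Δ := (u (k + 1)).z - (u k).z with hΔ
  set ρ := (u (k + 1)).y - (u (k + 1)).z with hρ
  have hsn : |D.snd| ≤ δ := Real.abs_le_sqrt (by
    rw [stepSq, ← hD, ← hΔ, ← hρ]
    linarith [sq_nonneg ‖Δ‖, sq_nonneg ‖ρ‖, sq_nonneg ‖(u k).y - (u k).z‖])
  have hΔn : ‖Δ‖ ≤ δ := Real.le_sqrt_of_sq_le (by
    rw [stepSq, ← hD, ← hΔ, ← hρ]
    linarith [sq_nonneg D.snd, sq_nonneg ‖ρ‖, sq_nonneg ‖(u k).y - (u k).z‖])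
  have hρn : ‖ρ‖ ≤ δ := Real.le_sqrt_of_sq_le (by
    rw [stepSq, ← hD, ← hΔ, ← hρ]
    linarith [sq_nonneg D.snd, sq_nonneg ‖Δ‖, sq_nonneg ‖(u k).y - (u k).z‖])
  have hρn' : ‖(u k).y - (u k).z‖ ≤ δ := Real.le_sqrt_of_sq_le (by
    rw [stepSq, ← hD, ← hΔ, ← hρ]
    linarith [sq_nonneg D.snd, sq_nonneg ‖Δ‖, sq_nonneg ‖ρ‖])
  have hDn : ‖D‖ ≤ 4 * δ := by
    -- `y⁺ - y = (z⁺ - z) + (y⁺ - z⁺) - (y - z)`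
    have e : D.fst = Δ + ρ - ((u k).y - (u k).z) := by
      rw [hD, WithLp.sub_fst, ← Pt.y_eq, ← Pt.y_eq, hΔ, hρ]; abel
    have h1 : ‖D.fst‖ ≤ 3 * δ := by
      rw [e]
      linarith [norm_sub_le (Δ + ρ) ((u k).y - (u k).z), norm_add_le Δ ρ]
    refine le_of_sq_le_sq ?_ (by positivity)
    rw [Ext.norm_sq, ← sq_abs D.snd]
    nlinarith [norm_nonneg D.fst, abs_nonneg D.snd]
  have hx := (hu k).2.2
  rw [← hρ] at hx
  have hxn : ‖(u (k + 1)).x - (u k).x‖ ≤ tau * sig * δ := by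
    rw [hx, add_sub_cancel_left, norm_smul, Real.norm_of_nonneg (by positivity)]
    gcongr
  have hτσ := mul_nonneg (mul_pos htau hsig).le hδ0
  have hσ := mul_nonneg hsig.le hδ0
  have hσr := mul_nonneg (mul_pos hsig hr).le hδ0
  have hLδ := mul_nonneg hL hδ0
  have hSδ := mul_nonneg (norm_nonneg Sig) hδ0
  refine ⟨?_, ?_, ?_, _, hu.isL1Subgradient hl hsig k, ?_⟩
  · have h := (u (k + 1) - u k).norm_le
    rw [Pt.yt_sub, Pt.z_sub, Pt.x_sub] at h
    rw [hC]
    linarith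
  · -- test the optimality condition of the `ỹ`-step against the residual itself
    set p := ∇ f (u (k + 1)).yt + ext (u (k + 1)).x 0 with hp
    have hst := hu.stationary hSig k p
    have e1 : ‖p‖ ^ 2 = ⟪∇ f (u (k + 1)).yt, p⟫_ℝ + ⟪p.fst, (u (k + 1)).x⟫_ℝ := by
      rw [← real_inner_self_eq_norm_sq]
      conv_lhs => rw [hp, inner_add_left, inner_ext_zero, ← hp]
      rw [real_inner_comm p.fst]
    have e2 : (u k).x + sig • ((u (k + 1)).y - (u k).z) =
        (u (k + 1)).x - ((tau * sig) • ρ - sig • (ρ + Δ)) := by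
      rw [hx, hρ, hΔ]
      module
    rw [e2, inner_sub_right] at hst
    have b1 : ⟪∇ f (u (k + 1)).yt - ∇ f (u k).yt, p⟫_ℝ ≤ L * (4 * δ) * ‖p‖ :=
      (real_inner_le_norm _ _).trans (mul_le_mul_of_nonneg_right
        ((hLip _ _).trans (mul_le_mul_of_nonneg_left hDn hL)) (norm_nonneg p))
    have b2 : -⟪p, Sig D⟫_ℝ ≤ ‖p‖ * (‖Sig‖ * (4 * δ)) := by
      refine neg_le.1 (neg_le_of_abs_le ((abs_real_inner_le_norm _ _).trans ?_))
      exact mul_le_mul_of_nonneg_left ((Sig.le_opNorm D).trans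
        (mul_le_mul_of_nonneg_left hDn (norm_nonneg _))) (norm_nonneg _)
    have b3 : -(p.snd * D.snd) ≤ ‖p‖ * δ := by
      refine neg_le.1 (neg_le_of_abs_le ?_)
      rw [abs_mul]
      exact mul_le_mul (WithLp.norm_snd_le _ p) hsn (abs_nonneg _) (norm_nonneg _)
    have b3' := mul_le_mul_of_nonneg_left b3 (mul_pos hsig hr).le
    have b4 : ⟪p.fst, (tau * sig) • ρ - sig • (ρ + Δ)⟫_ℝ ≤
        ‖p‖ * (tau * sig * δ + sig * (2 * δ)) := by
      refine (real_inner_le_norm _ _).trans (mul_le_mul (WithLp.norm_fst_le _ p) ?_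
        (norm_nonneg _) (norm_nonneg _))
      refine (norm_sub_le _ _).trans ?_
      rw [norm_smul, norm_smul, Real.norm_of_nonneg (by positivity : 0 ≤ tau * sig),
        Real.norm_of_nonneg hsig.le]
      have := norm_add_le ρ Δ
      gcongr
      linarith
    rw [inner_sub_left] at b1
    have hpp : ‖p‖ * ‖p‖ ≤ ‖p‖ * (C * δ) := by
      have hpδ := mul_nonneg (norm_nonneg p) hδ0
      rw [hC, ← sq, e1]
      linarith
    rcases (norm_nonneg p).eq_or_lt with h0 | h0
    · rw [← h0]; positivity
    · exact le_of_mul_le_mul_left hpp h0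
  · rw [hC]
    linarith
  · have e : (u k).x + sig • ρ - (u (k + 1)).x = sig • ρ - (tau * sig) • ρ := by
      rw [hx]; abel
    rw [← hρ, e]
    refine (norm_sub_le _ _).trans ?_
    rw [norm_smul, norm_smul, Real.norm_of_nonneg (by positivity : 0 ≤ tau * sig),
      Real.norm_of_nonneg hsig.le]
    have h1 := mul_le_mul_of_nonneg_left hρn hsig.le
    have h2 := mul_le_mul_of_nonneg_left hρn (mul_pos htau hsig).le
    rw [hC]
    linarith

end Residual

/-! ### Linear convergence -/

section Rate

/-- **Linear convergence from descent and an error bound.** Let `0 ≤ Q ≤ C ‖·‖²`. If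
`Q (u k - w)` decreases by `θ e k` for every `w ∈ Ω`, and if `e k` dominates both the squared step
and the squared distance of the new point to `Ω`, then the `Q`-distance to `Ω` contracts and the
sequence converges to a point of `Ω` at a geometric rate. -/
theorem linear_convergence {E : Type*} [NormedAddCommGroup E] [CompleteSpace E] {Om : Set E}
    (hcl : IsClosed Om) (hne : Om.Nonempty) {Q : E → ℝ} {C : ℝ} (hC : 0 < C)
    (hQ0 : ∀ v, 0 ≤ Q v) (hQ : ∀ v, Q v ≤ C * ‖v‖ ^ 2) {u : ℕ → E} {e : ℕ → ℝ} {θ C₁ C₂ : ℝ}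
    (he : ∀ k, 0 ≤ e k) (hθ : 0 < θ)
    (hdesc : ∀ k, ∀ w ∈ Om, Q (u (k + 1) - w) + θ * e k ≤ Q (u k - w))
    (hC₁ : 0 ≤ C₁) (hstep : ∀ k, ‖u (k + 1) - u k‖ ≤ C₁ * √(e k))
    (hC₂ : 0 ≤ C₂) (hdist : ∀ k, ∃ w ∈ Om, ‖u (k + 1) - w‖ ≤ C₂ * √(e k)) :
    ∃ ubar ∈ Om, Filter.Tendsto u Filter.atTop (nhds ubar) ∧
      (∃ mu : ℝ, 0 < mu ∧ mu < 1 ∧ ∀ k, sInf ((fun w => Q (u (k + 1) - w)) '' Om) ≤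
        mu * sInf ((fun w => Q (u k - w)) '' Om)) ∧
      ∃ A q : ℝ, 0 < A ∧ 0 < q ∧ q < 1 ∧ ∀ k, ‖u k - ubar‖ ≤ A * q ^ k := by
  set d : ℕ → ℝ := fun k => sInf ((fun w => Q (u k - w)) '' Om) with hd
  have hbdd : ∀ k, BddBelow ((fun w => Q (u k - w)) '' Om) := fun k =>
    ⟨0, by rintro _ ⟨w, -, rfl⟩; exact hQ0 _⟩
  have hd0 : ∀ k, 0 ≤ d k := fun k =>
    Real.sInf_nonneg (by rintro _ ⟨w, -, rfl⟩; exact hQ0 _)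
  have hdle : ∀ k, ∀ w ∈ Om, d k ≤ Q (u k - w) := fun k w hw =>
    csInf_le (hbdd k) ⟨w, hw, rfl⟩
  have hdd : ∀ k, d (k + 1) + θ * e k ≤ d k := fun k => by
    refine le_csInf (hne.image _) ?_
    rintro _ ⟨w, hw, rfl⟩
    have h1 := hdesc k w hw
    have h2 := hdle (k + 1) w hw
    simp only
    linarith
  have hde : ∀ k, d (k + 1) ≤ C * C₂ ^ 2 * e k := fun k => by
    obtain ⟨w, hw, h⟩ := hdist k
    refine (hdle (k + 1) w hw).trans ((hQ _).trans ?_)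
    have h1 : ‖u (k + 1) - w‖ ^ 2 ≤ (C₂ * √(e k)) ^ 2 := by gcongr
    rw [mul_pow, Real.sq_sqrt (he k)] at h1
    rw [mul_assoc]
    exact mul_le_mul_of_nonneg_left h1 hC.le
  -- the contraction factor `T / (1 + T)`, with `T` enlarged to keep it positive
  set T : ℝ := C * C₂ ^ 2 / θ + 1 with hT
  have hT0 : 0 < T := by positivity
  have hcontr : ∀ k, d (k + 1) ≤ T / (1 + T) * d k := fun k => by
    have h1 := hdd k
    have h2 : θ * e k ≤ d k - d (k + 1) := by linarith
    have h3 : d (k + 1) ≤ T * (d k - d (k + 1)) := by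
      have h4 : C * C₂ ^ 2 / θ * (θ * e k) ≤ C * C₂ ^ 2 / θ * (d k - d (k + 1)) := by gcongr
      have h5 : C * C₂ ^ 2 / θ * (θ * e k) = C * C₂ ^ 2 * e k := by field_simp
      have h6 : 0 ≤ d k - d (k + 1) := (mul_nonneg hθ.le (he k)).trans h2
      rw [hT, add_mul, one_mul]
      linarith [hde k]
    rw [div_mul_eq_mul_div, le_div_iff₀ (by positivity)]
    linarith
  set mu : ℝ := T / (1 + T) with hmu
  have hmu0 : 0 < mu := by positivity
  have hmu1 : mu < 1 := by rw [hmu, div_lt_one (by positivity)]; linarith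
  have hdk : ∀ k, d k ≤ d 0 * mu ^ k := fun k => by
    induction k with
    | zero => simp
    | succ k ih =>
      rw [pow_succ', mul_left_comm]
      exact (hcontr k).trans (mul_le_mul_of_nonneg_left ih hmu0.le)
  set q : ℝ := √mu with hq
  have hq0 : 0 < q := Real.sqrt_pos.2 hmu0
  have hq1 : q < 1 := by
    rw [hq, Real.sqrt_lt' one_pos]
    simpa using hmu1
  have hqk : ∀ k, √(mu ^ k) = q ^ k := fun k => by
    rw [Real.sqrt_eq_iff_mul_self_eq (by positivity) (by positivity), ← mul_pow, hq,
      Real.mul_self_sqrt hmu0.le]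
  have hek : ∀ k, √(e k) ≤ √(d 0 / θ) * q ^ k := fun k => by
    rw [← hqk, ← Real.sqrt_mul (div_nonneg (hd0 0) hθ.le)]
    refine Real.sqrt_le_sqrt ?_
    rw [div_mul_eq_mul_div, le_div_iff₀ hθ, mul_comm]
    exact (by linarith [hdd k, hd0 (k + 1)] : θ * e k ≤ d k).trans (hdk k)
  have hgeo : ∀ k, dist (u k) (u (k + 1)) ≤ C₁ * √(d 0 / θ) * q ^ k := fun k => by
    rw [dist_comm, dist_eq_norm, mul_assoc]
    exact (hstep k).trans (mul_le_mul_of_nonneg_left (hek k) hC₁)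
  obtain ⟨ubar, hlim⟩ := cauchySeq_tendsto_of_complete (cauchySeq_of_le_geometric q _ hq1 hgeo)
  have hrate : ∀ k, ‖u k - ubar‖ ≤ (C₁ * √(d 0 / θ) / (1 - q) + 1) * q ^ k := fun k => by
    have h := dist_le_of_le_geometric_of_tendsto q _ hq1 hgeo hlim k
    rw [dist_eq_norm] at h
    refine h.trans ?_
    rw [add_mul, ← div_mul_eq_mul_div]
    have : 0 < q ^ k := by positivity
    linarith
  have hmem : ubar ∈ Om := by
    choose w hw hwd using hdist
    have h0 : Filter.Tendsto (fun k => C₂ * (√(d 0 / θ) * q ^ k)) Filter.atTop (nhds 0) := by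
      have := ((tendsto_pow_atTop_nhds_zero_of_lt_one hq0.le hq1).const_mul
        √(d 0 / θ)).const_mul C₂
      simpa using this
    have h1 : Filter.Tendsto (fun k => u (k + 1) - w k) Filter.atTop (nhds 0) :=
      squeeze_zero_norm (fun k => (hwd k).trans (mul_le_mul_of_nonneg_left (hek k) hC₂)) h0
    have h2 : Filter.Tendsto w Filter.atTop (nhds ubar) := by
      simpa using (hlim.comp (Filter.tendsto_add_atTop_nat 1)).sub h1
    exact hcl.mem_of_tendsto h2 (Filter.Eventually.of_forall hw)
  have hpos : 0 < 1 - q := sub_pos.2 hq1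
  exact ⟨ubar, hmem, hlim, ⟨mu, hmu0, hmu1, hcontr⟩, _, q, by positivity, hq0, hq1, hrate⟩

end Rate

end LassoLogistic

end

theorem proposition5p1
    (n N : ℕ) (hN : 0 < N)
    (B : Fin N → LassoLogistic.Vec n) (b : Fin N → ℝ) (hb : ∀ i, b i = 1 ∨ b i = -1)
    (lam₁ lam₂ : ℝ) (hlam₁ : 0 ≤ lam₁) (hlam₂ : lam₂ = 0)
    (Sig : LassoLogistic.Ext n →L[ℝ] LassoLogistic.Ext n)
    (hSig : LassoLogistic.IsMajorizer (LassoLogistic.loss B b) Sig)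
    (hKKT : (LassoLogistic.kktSet (LassoLogistic.loss B b)
      (LassoLogistic.fusedLasso lam₁ lam₂)).Nonempty)
    (sig tau r : ℝ) (hsig : 0 < sig) (htau : 0 < tau) (htau' : tau < (1 + √5) / 2) (hr : 0 < r)
    (u : ℕ → LassoLogistic.Pt n)
    (hu : LassoLogistic.IsIPADMM (LassoLogistic.loss B b) (LassoLogistic.fusedLasso lam₁ lam₂)
      Sig (LassoLogistic.proxTerm Sig sig r) sig tau u) :
    ∃ ubar ∈ LassoLogistic.kktSet (LassoLogistic.loss B b) (LassoLogistic.fusedLasso lam₁ lam₂),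
      Filter.Tendsto u Filter.atTop (nhds ubar) ∧
      (∃ mu : ℝ, 0 < mu ∧ mu < 1 ∧ ∀ k : ℕ, 1 ≤ k →
        LassoLogistic.distMSq Sig (LassoLogistic.proxTerm Sig sig r) sig tau
            (LassoLogistic.kktSet (LassoLogistic.loss B b) (LassoLogistic.fusedLasso lam₁ lam₂))
            (u (k + 1)) ≤
          mu * LassoLogistic.distMSq Sig (LassoLogistic.proxTerm Sig sig r) sig tau
            (LassoLogistic.kktSet (LassoLogistic.loss B b) (LassoLogistic.fusedLasso lam₁ lam₂))
            (u k)) ∧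
      (∃ C q : ℝ, 0 < C ∧ 0 < q ∧ q < 1 ∧ ∀ k : ℕ, ‖u k - ubar‖ ≤ C * q ^ k) := by
  open LassoLogistic in
  subst hlam₂
  have hf := loss_add_inner_le B b
  obtain ⟨L, hL, hLip⟩ := exists_lipschitz_gradient_loss B b
  obtain ⟨c, C, hc, hC, hM⟩ := exists_normMSq_bounds hSig.1 hsig htau htau' hr
  obtain ⟨θ, hθ, hdesc⟩ := hu.exists_descent hf hSig hlam₁ hsig htau htau' hr
  obtain ⟨C', hC', hres⟩ := hu.exists_residual_le hL hLip hSig.1 hlam₁ hsig htau hr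
  set Q := normMSq Sig (proxTerm Sig sig r) sig tau with hQ
  have hQ0 : ∀ v, 0 ≤ Q v := fun v => (by positivity : 0 ≤ c * ‖v‖ ^ 2).trans (hM v).1
  -- the descent keeps the iterates from `u 1` on in a bounded set
  obtain ⟨w₀, hw₀⟩ := hKKT
  have hmono : ∀ k, Q (u (k + 1) - w₀) ≤ Q (u 1 - w₀) := fun k => by
    induction k with
    | zero => exact le_rfl
    | succ k ih =>
      have := hdesc k w₀ hw₀
      have := mul_nonneg hθ.le (stepSq_nonneg u (k + 1))
      linarith
  have hbdd : ∀ k, ‖u (k + 1)‖ ≤ √(Q (u 1 - w₀) / c) + ‖w₀‖ := fun k => by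
    have h1 : ‖u (k + 1) - w₀‖ ≤ √(Q (u 1 - w₀) / c) := by
      refine Real.le_sqrt_of_sq_le ?_
      rw [le_div_iff₀ hc, mul_comm]
      exact (hM _).1.trans (hmono k)
    have h2 : ‖u (k + 1)‖ ≤ ‖u (k + 1) - w₀‖ + ‖w₀‖ := by
      simpa using norm_add_le (u (k + 1) - w₀) w₀
    linarith
  obtain ⟨K, hK, herr⟩ := exists_error_bound (B := B) (b := b) hN hlam₁ ⟨w₀, hw₀⟩
    (√(Q (u 1 - w₀) / c) + ‖w₀‖)
  -- the descent inequality needs a preceding step, so the sequence is started at `u 1`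
  obtain ⟨ubar, hubar, hlim, ⟨mu, hmu0, hmu1, hmu⟩, A, q, hA, hq0, hq1, hrate⟩ :=
    linear_convergence (isClosed_kktSet hlam₁ (continuous_gradient_loss B b)) ⟨w₀, hw₀⟩ hC hQ0
      (fun v => (hM v).2) (u := fun k => u (k + 1)) (fun k => stepSq_nonneg u (k + 1)) hθ hdesc
      hC' (fun k => (hres (k + 1)).1) (mul_nonneg hK hC') (fun k => by
        obtain ⟨-, h1, h2, x, h3, h4⟩ := hres (k + 1)
        rw [mul_assoc]
        exact herr _ x _ (hbdd (k + 1)) h1 h3 h4 h2)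
  refine ⟨ubar, hubar, (Filter.tendsto_add_atTop_iff_nat 1).1 hlim, ⟨mu, hmu0, hmu1, ?_⟩,
    A / q + ‖u 0 - ubar‖, q, by positivity, hq0, hq1, ?_⟩
  · intro k hk
    obtain ⟨k, rfl⟩ := Nat.exists_eq_add_of_le' hk
    exact hmu k
  · rintro (_ | k)
    · rw [pow_zero, mul_one]
      linarith [div_pos hA hq0]
    · refine (hrate k).trans ?_
      have e : A * q ^ k = A / q * q ^ (k + 1) := by rw [pow_succ']; field_simp
      rw [e]
      have := norm_nonneg (u 0 - ubar)
      gcongr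
      linarith
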